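/- Let $\{W_{in}\}_{1\le i\le n,\ n\ge 1}$ be a triangular array of real random variables on a probability space $(\Omega,\mathcal F,\mathbb P)$ such that, for each $n$, the variables $W_{1n},\dots,W_{nn}$ are independent and have mean zero. Suppose that there are constants $\theta,\beta>0$ such that $$\mathbb P[|W_{in}|\ge t]\le\theta e^{-\beta t}\qquad\text{for all } t>0 \text{ and all } 1\le i\le n,\ n\ge1,$$ and that $$\liminf_{n\to\infty}\ \frac1n\sum_{i=1}^n\mathbb E[W_{in}^2]>0.$$ Let $w_n$ be a (deterministic) real sequence with $w_n\to0$. Write $$K_{in}(s)=\log\mathbb E[\exp(sW_{in})],\qquad K_n(s)=\frac1n\sum_{i=1}^nK_{in}(s).$$ Call $\varepsilon>0$ admissible if $K_{in}(s)<\infty$ for all $s\in(-\varepsilon,\varepsilon)$ and all $1\le i\le n$, $n\ge1$ (all the $K_{in}$ are then smooth on $(-\varepsilon,\varepsilon)$). For an admissible $\varepsilon$ let $$S_n=\{s\in[-\varepsilon/2,\varepsilon/2]: K_n'(s)=w_n\},$$ let $\hat s_n$ be the single element of $S_n$ if $|S_n|=1$ and $\hat s_n=\frac{\varepsilon}{2}\operatorname{sgn}(w_n)$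 otherwise, and put $$\lambda_n=\hat s_n\sqrt{nK_n''(\hat s_n)},\qquad r_n=\begin{cases}\operatorname{sgn}(\hat s_n)\sqrt{2n(\hat s_nw_n-K_n(\hat s_n))}&\text{if }\hat s_nw_n-K_n(\hat s_n)\ge0,\\ \operatorname{sgn}(\hat s_n)&\text{otherwise,}\end{cases}$$ $$\widehat{\mathbb P}_{\mathrm{LR},n}=1-\Phi(r_n)+\phi(r_n)\left\{\frac1{\lambda_n}-\frac1{r_n}\right\},$$ where $\Phi$ and $\phi$ are the distribution function and the density of the standard normal law and $1/0-1/0=0$ by convention. Then admissible $\varepsilon$ exist; indeed every $\varepsilon\in(0,\beta]$ is admissible. Moreover, for every admissible $\varepsilon>0$: 1. for all sufficiently large $n$, the saddlepoint equation $K_n'(s)=w_n$ has a unique solution in $[-\varepsilon/2,\varepsilon/2]$, that is, $|S_n|=1$; 2. the Lugannani–Rice approximation has vanishing relative error: as $n\to\infty$, $$\mathbb P\left[\frac1n\sum_{i=1}^nW_{in}\ge w_n\right]=\widehat{\mathbb P}_{\mathrm{LR},n}\,(1+o(1)).$$ -/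

import Mathlib

open MeasureTheory ProbabilityTheory Filter Topology

namespace Saddlepoint

variable {Ω : Type*} [MeasurableSpace Ω]

/-- The row average `(1/n) ∑_{i ≤ n} W_{in}` of a triangular array. The entry `W_{in}` is
`W n i` with `i : Fin n`. -/
noncomputable def rowAverage (W : (n : ℕ) → Fin n → Ω → ℝ) (n : ℕ) (ω : Ω) : ℝ :=
  (1 / (n : ℝ)) * ∑ i : Fin n, W n i ω

/-- All cumulant generating functions of the array are finite on `(-ε, ε)`, that is,
`exp (s W_{in})` is integrable for all `|s| < ε` and all `n`, `i`. -/
def FiniteCGF (W : (n : ℕ) → Fin n → Ω → ℝ) (μ : Measure Ω) (ε : ℝ) : Prop :=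
  ∀ (n : ℕ) (i : Fin n), ∀ s ∈ Set.Ioo (-ε) ε,
    Integrable (fun ω => Real.exp (s * W n i ω)) μ

/-- `K_n(s) = (1/n) ∑_{i ≤ n} K_{in}(s)`, with `K_{in}(s) = log E[exp (s W_{in})]`. -/
noncomputable def avgCGF (W : (n : ℕ) → Fin n → Ω → ℝ) (μ : Measure Ω) (n : ℕ) (s : ℝ) : ℝ :=
  (1 / (n : ℝ)) * ∑ i : Fin n, cgf (W n i) μ s

/-- Where the generating functions are finite, `K_n` is analytic, so that its derivatives below
are genuine ones. -/
theorem FiniteCGF.analyticOnNhd {W : (n : ℕ) → Fin n → Ω → ℝ} {μ : Measure Ω} {ε : ℝ}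
    (h : FiniteCGF W μ ε) (n : ℕ) : AnalyticOnNhd ℝ (avgCGF W μ n) (Set.Ioo (-ε) ε) := by
  intro s hs
  unfold avgCGF
  refine analyticAt_const.mul (Finset.analyticAt_fun_sum _ fun i _ => analyticAt_cgf ?_)
  exact mem_interior.2 ⟨Set.Ioo (-ε) ε, fun t ht => h n i t ht, isOpen_Ioo, hs⟩

/-- The set `S_n` of solutions `s ∈ [-ε/2, ε/2]` of the saddlepoint equation `K_n'(s) = w`. -/
def solutionSet (W : (n : ℕ) → Fin n → Ω → ℝ) (μ : Measure Ω) (ε : ℝ) (n : ℕ) (w : ℝ) : Set ℝ :=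
  {s | s ∈ Set.Icc (-(ε / 2)) (ε / 2) ∧ HasDerivAt (avgCGF W μ n) w s}

open Classical in
/-- The saddlepoint `ŝ_n`: the element of `S_n` if there is exactly one, and `(ε/2) sgn w`
otherwise. -/
noncomputable def saddlepoint (W : (n : ℕ) → Fin n → Ω → ℝ) (μ : Measure Ω) (ε : ℝ) (n : ℕ)
    (w : ℝ) : ℝ :=
  if h : ∃! s, s ∈ solutionSet W μ ε n w then h.choose else ε / 2 * Real.sign w

/-- `λ_n = ŝ_n √(n K_n''(ŝ_n))`. -/
noncomputable def lam (W : (n : ℕ) → Fin n → Ω → ℝ) (μ : Measure Ω) (ε : ℝ) (n : ℕ)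
    (w : ℝ) : ℝ :=
  saddlepoint W μ ε n w *
    Real.sqrt (n * iteratedDeriv 2 (avgCGF W μ n) (saddlepoint W μ ε n w))

open Classical in
/-- `r_n = sgn(ŝ_n) √(2n (ŝ_n w - K_n(ŝ_n)))` if `ŝ_n w - K_n(ŝ_n) ≥ 0`, and `sgn(ŝ_n)`
otherwise. -/
noncomputable def rr (W : (n : ℕ) → Fin n → Ω → ℝ) (μ : Measure Ω) (ε : ℝ) (n : ℕ)
    (w : ℝ) : ℝ :=
  if 0 ≤ saddlepoint W μ ε n w * w - avgCGF W μ n (saddlepoint W μ ε n w) then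
    Real.sign (saddlepoint W μ ε n w) *
      Real.sqrt (2 * n * (saddlepoint W μ ε n w * w - avgCGF W μ n (saddlepoint W μ ε n w)))
  else Real.sign (saddlepoint W μ ε n w)

/-- The Lugannani-Rice formula `1 - Φ(r) + φ(r) (1/λ - 1/r)`, with `Φ` and `φ` the distribution
function and the density of `N(0, 1)`. The convention `1/0 - 1/0 = 0` agrees with division by zero
in Mathlib, and gives the value `1/2` at `λ = r = 0`. -/
noncomputable def lugannaniRice (W : (n : ℕ) → Fin n → Ω → ℝ) (μ : Measure Ω) (ε : ℝ) (n : ℕ)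
    (w : ℝ) : ℝ :=
  1 - cdf (gaussianReal 0 1) (rr W μ ε n w) +
    gaussianPDFReal 0 1 (rr W μ ε n w) * (1 / lam W μ ε n w - 1 / rr W μ ε n w)

end Saddlepoint

/-! Write `S` for the row sum, `x = n w`, `s` for the saddlepoint, `V` for the sum of the second
cumulant derivatives at `s`, `λ = s √V`, and `q = s x - ∑ K_i(s)`, so that `q = r² / 2`. Under the
law tilted by `exp (s S)` the summands stay independent, and `S` has mean `x` and variance `V`. With
`Z = (S - x) / √V`, undoing the tilt gives `exp q * P[S ≥ x] = E[exp (-λ Z); Z ≥ 0]`, the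
expectation being under the tilted law. For a standard normal `Z` the right side would be `φ(0)
M(λ)`, where `M` is the Mills ratio. Hence the main term is `T = φ(r) M(λ)`.

For `s ≥ 0`, both the tail probability and the Lugannani–Rice value have relative distance `O(s +
1/√V)` from `T`. For the probability this is a Berry–Esseen bound, of order `1/√V`: the test
function is monotone on a half line, so a bound on distribution functions suffices. Since `M(λ)` is
at least of order `1/(1 + λ)` (`mills_lower`), the relative error is `O((1 + λ)/√V) = O(s + 1/√V)`
(`tail_sum_estimate`, `row_estimate_nonneg`). For the formula, `1 - Φ(r) = φ(r) M(r)` turns it into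
`φ(r) (M(r) + 1/λ - 1/r)`. A Taylor expansion of the Legendre transform gives `r = λ (1 + O(s))`, so
`M(r)` is relatively close to `M(λ)`, while `1/λ - 1/r = O(s/λ) = O(1/√V)` (`abs_lrValue_sub_le`). A
negative saddlepoint is reduced to a positive one by reflecting the variables and passing to
complements (`row_estimate`).

The exponential tails bound the cumulant derivatives up to order three uniformly near zero. Together
with the variance condition this makes the averaged second derivative bounded below near zero, so
the saddlepoint equation has a root tending to zero and `V` tends to infinity. Convexity excludes
other roots in the whole interval (`exists_saddle_row`). The Berry–Esseen bound for non-identically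
distributed summands is proved by Stein's method, with a leave-one-out concentration inequality
controlling the jump in the derivative of the Stein solution. -/

namespace Saddlepoint

/-! ### The Mills ratio: monotonicity, bounds, differential equation -/

/-- The Mills ratio `∫_0^∞ exp (-x u - u² / 2) du = exp (x² / 2) ∫_x^∞ exp (-t² / 2) dt`. -/
noncomputable def mills (x : ℝ) : ℝ := ∫ u in Set.Ioi (0 : ℝ), Real.exp (-x * u - u ^ 2 / 2)

theorem integrable_mills (x : ℝ) : Integrable (fun u : ℝ => Real.exp (-x * u - u ^ 2 / 2)) := by
  have h := (integrable_exp_neg_mul_sq (b := 1 / 4) (by norm_num)).const_mul (Real.exp (x ^ 2))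
  refine h.mono' (by fun_prop) (ae_of_all _ fun u => ?_)
  rw [Real.norm_eq_abs, Real.abs_exp, ← Real.exp_add]
  exact Real.exp_le_exp.2 (by nlinarith [sq_nonneg (x + u / 2)])

theorem mills_pos (x : ℝ) : 0 < mills x := by
  unfold mills
  rw [setIntegral_pos_iff_support_of_nonneg_ae]
  · have : Function.support (fun u : ℝ => Real.exp (-x * u - u ^ 2 / 2)) = Set.univ := by
      ext u; simp [Real.exp_ne_zero]
    rw [this]; simp
  · exact ae_of_all _ fun u => (Real.exp_pos _).le
  · exact (integrable_mills x).integrableOn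

theorem mills_antitone : Antitone mills := by
  intro x y hxy
  refine setIntegral_mono_on (integrable_mills y).integrableOn (integrable_mills x).integrableOn
    measurableSet_Ioi fun u hu => Real.exp_le_exp.2 ?_
  have : 0 < u := hu
  nlinarith

/-- Dropping the Gaussian factor leaves the integral of `exp (-x u)`, which is `1 / x`. -/
theorem mul_mills_le_one {x : ℝ} (hx : 0 ≤ x) : x * mills x ≤ 1 := by
  rcases hx.eq_or_lt with rfl | hx
  · simp
  have h1 : mills x ≤ ∫ u in Set.Ioi (0 : ℝ), Real.exp (-x * u) := by
    refine setIntegral_mono_on (integrable_mills x).integrableOn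
      (integrableOn_exp_mul_Ioi (by linarith) 0) measurableSet_Ioi fun u hu =>
      Real.exp_le_exp.2 (by nlinarith [sq_nonneg u])
  rw [integral_exp_mul_Ioi (by linarith)] at h1
  calc x * mills x ≤ x * (-Real.exp (-x * 0) / -x) := by gcongr
    _ = 1 := by simp; field_simp

/-- `x ↦ x * mills x` is monotone, in scaled form. -/
theorem mills_le_mul_mills_mul {c : ℝ} (hc : 1 ≤ c) (x : ℝ) : mills x ≤ c * mills (c * x) := by
  have hc0 : 0 < c := by linarith
  have h := integral_comp_mul_left_Ioi (fun u : ℝ => Real.exp (-x * u - u ^ 2 / 2 / c ^ 2)) 0 hc0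
  have h2 : mills (c * x) = c⁻¹ * ∫ u in Set.Ioi (0 : ℝ), Real.exp (-x * u - u ^ 2 / 2 / c ^ 2) := by
    rw [mul_zero, smul_eq_mul] at h
    rw [← h, mills]
    congr 1 with u
    congr 1
    field_simp
  have hint : IntegrableOn (fun u : ℝ => Real.exp (-x * u - u ^ 2 / 2 / c ^ 2)) (Set.Ioi 0) := by
    have h3 := ((integrable_mills (c * x)).integrableOn (s := Set.Ioi 0))
    have h4 := (integrableOn_Ioi_comp_mul_left_iff
      (fun u : ℝ => Real.exp (-x * u - u ^ 2 / 2 / c ^ 2)) 0 hc0)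
    rw [mul_zero] at h4
    rw [← h4]
    refine h3.congr_fun (fun u _ => ?_) measurableSet_Ioi
    simp only
    congr 1
    field_simp
  rw [h2, ← mul_assoc, mul_inv_cancel₀ hc0.ne', one_mul]
  refine setIntegral_mono_on (integrable_mills x).integrableOn hint measurableSet_Ioi fun u hu =>
      Real.exp_le_exp.2 ?_
  have : u ^ 2 / 2 / c ^ 2 ≤ u ^ 2 / 2 := div_le_self (by positivity) (one_le_pow₀ hc)
  linarith

/-- Compare both sides with `(1 + x) * mills (1 + x)`, using that `y * mills y` increases and
`mills` decreases. This is what turns additive errors of order `1/√V` into relative ones. -/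
theorem mills_lower {x : ℝ} (hx : 0 ≤ x) : mills 1 ≤ (1 + x) * mills x := by
  have h := mills_le_mul_mills_mul (c := 1 + x) (by linarith) 1
  have h2 : mills ((1 + x) * 1) ≤ mills x := mills_antitone (by linarith)
  nlinarith

theorem mills_eq (x : ℝ) :
    mills x = Real.exp (x ^ 2 / 2) * ∫ t in Set.Ioi x, Real.exp (-t ^ 2 / 2) := by
  have h := (measurePreserving_add_right volume x).setIntegral_preimage_emb
    (measurableEmbedding_addRight x) (fun t : ℝ => Real.exp (-t ^ 2 / 2)) (Set.Ioi x)
  have hs : (fun u : ℝ => u + x) ⁻¹' Set.Ioi x = Set.Ioi 0 := by ext; simp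
  rw [hs] at h
  rw [← h, ← integral_const_mul, mills]
  congr 1 with u
  rw [← Real.exp_add]
  congr 1
  ring

theorem integrable_exp_neg_sq_div_two : Integrable (fun t : ℝ => Real.exp (-t ^ 2 / 2)) := by
  have h := integrable_exp_neg_mul_sq (b := 1 / 2) (by norm_num)
  refine h.congr (ae_of_all _ fun u => ?_)
  simp only; congr 1; ring

/-- This differential equation is the Stein equation up to constants, so constant multiples of
`mills` on either side of the threshold solve the latter. -/
theorem hasDerivAt_mills (x : ℝ) : HasDerivAt mills (x * mills x - 1) x := by
  have h1 : ∀ y : ℝ, ∫ t in Set.Ioi y, Real.exp (-t ^ 2 / 2) =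
      (∫ t in Set.Ioi (0 : ℝ), Real.exp (-t ^ 2 / 2)) - ∫ t in (0 : ℝ)..y, Real.exp (-t ^ 2 / 2) := by
    intro y
    rw [eq_sub_iff_add_eq, add_comm]
    exact intervalIntegral.integral_interval_add_Ioi
      integrable_exp_neg_sq_div_two.integrableOn integrable_exp_neg_sq_div_two.integrableOn
  have h2 : HasDerivAt (fun y : ℝ => ∫ t in Set.Ioi y, Real.exp (-t ^ 2 / 2))
      (-Real.exp (-x ^ 2 / 2)) x := by
    rw [funext h1]
    refine HasDerivAt.const_sub _ ?_
    exact (by fun_prop : Continuous fun t : ℝ => Real.exp (-t ^ 2 / 2)).integral_hasStrictDerivAt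
      0 x |>.hasDerivAt
  have h3 : HasDerivAt (fun y : ℝ => Real.exp (y ^ 2 / 2)) (Real.exp (x ^ 2 / 2) * x) x := by
    have := ((hasDerivAt_pow 2 x).div_const 2).exp
    refine this.congr_deriv ?_
    norm_num
  have h4 := h3.mul h2
  have h5 : (fun y : ℝ => Real.exp (y ^ 2 / 2)) *
      (fun y : ℝ => ∫ t in Set.Ioi y, Real.exp (-t ^ 2 / 2)) = mills := by
    ext y; rw [mills_eq]; rfl
  rw [h5] at h4
  refine h4.congr_deriv ?_
  rw [mills_eq]
  have : Real.exp (x ^ 2 / 2) * Real.exp (-x ^ 2 / 2) = 1 := by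
    rw [← Real.exp_add, ← Real.exp_zero]; congr 1; ring
  linear_combination -this

/-! ### The normal distribution in terms of the Mills ratio -/

theorem gaussianPDFReal_zero_one (x : ℝ) :
    gaussianPDFReal 0 1 x = (√(2 * Real.pi))⁻¹ * Real.exp (-x ^ 2 / 2) := by
  simp [gaussianPDFReal]

theorem one_sub_cdf_gaussianReal (x : ℝ) :
    1 - cdf (gaussianReal 0 1) x = gaussianPDFReal 0 1 x * mills x := by
  rw [cdf_eq_real, ← probReal_compl_eq_one_sub measurableSet_Iic, Set.compl_Iic, measureReal_def,
    gaussianReal_apply_eq_integral _ one_ne_zero, ENNReal.toReal_ofReal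
      (integral_nonneg fun _ => gaussianPDFReal_nonneg _ _ _), mills_eq]
  simp_rw [gaussianPDFReal_zero_one]
  rw [integral_const_mul]
  have : Real.exp (x ^ 2 / 2) * Real.exp (-x ^ 2 / 2) = 1 := by
    rw [← Real.exp_add, ← Real.exp_zero]; congr 1; ring
  linear_combination
    (-((√(2 * Real.pi))⁻¹ * ∫ t in Set.Ioi x, Real.exp (-t ^ 2 / 2))) * this

theorem gaussianPDFReal_neg (x : ℝ) : gaussianPDFReal 0 1 (-x) = gaussianPDFReal 0 1 x := by
  simp [gaussianPDFReal_zero_one]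

theorem cdf_gaussianReal_neg (x : ℝ) :
    cdf (gaussianReal 0 1) (-x) = 1 - cdf (gaussianReal 0 1) x := by
  have h : (gaussianReal 0 1).map (fun x => -x) = gaussianReal 0 1 := by
    simpa using gaussianReal_map_neg (μ := 0) (v := 1)
  have : NullSingletonClass (gaussianReal 0 1) := nullSingletonClass_gaussianReal one_ne_zero
  rw [cdf_eq_real, cdf_eq_real, ← probReal_compl_eq_one_sub measurableSet_Iic, Set.compl_Iic]
  conv_lhs => rw [← h]
  rw [map_measureReal_apply measurable_neg measurableSet_Iic]
  have : (fun x : ℝ => -x) ⁻¹' Set.Iic (-x) = Set.Ici x := by ext; simp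
  rw [this]
  exact measureReal_congr Ioi_ae_eq_Ici.symm

theorem cdf_gaussianReal_eq (x : ℝ) :
    cdf (gaussianReal 0 1) x = gaussianPDFReal 0 1 x * mills (-x) := by
  have := one_sub_cdf_gaussianReal (-x)
  rw [cdf_gaussianReal_neg, gaussianPDFReal_neg] at this
  linarith

theorem mills_zero : gaussianPDFReal 0 1 0 * mills 0 = 1 / 2 := by
  have h1 := cdf_gaussianReal_eq 0
  have h2 := one_sub_cdf_gaussianReal 0
  rw [neg_zero] at h1
  linarith

theorem mills_zero_le : mills 0 ≤ 2 := by
  have h := mills_zero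
  rw [gaussianPDFReal_zero_one] at h
  have h3 : √(2 * Real.pi) ≤ 4 := by
    rw [Real.sqrt_le_left (by norm_num)]
    nlinarith [Real.pi_le_four]
  have h4 : 0 < √(2 * Real.pi) := by positivity
  simp at h
  have : √2 * √Real.pi = √(2 * Real.pi) := by rw [Real.sqrt_mul (by norm_num)]
  have h5 : mills 0 = √(2 * Real.pi) / 2 := by
    rw [← this]
    have a : √2 ≠ 0 := by positivity
    have b : √Real.pi ≠ 0 := by positivity
    field_simp at h ⊢
    linarith
  linarith

/-- The Gaussian value of the expectation that appears once a tail probability is written under the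
tilted law. -/
theorem integral_exp_indicator_gaussianReal (l : ℝ) :
    ∫ z, (Set.Ioi (0 : ℝ)).indicator (fun z => Real.exp (-l * z)) z ∂gaussianReal 0 1 =
      gaussianPDFReal 0 1 0 * mills l := by
  rw [integral_gaussianReal_eq_integral_smul one_ne_zero]
  have : ∀ z : ℝ, gaussianPDFReal 0 1 z • (Set.Ioi (0 : ℝ)).indicator (fun z => Real.exp (-l * z)) z
      = (Set.Ioi (0 : ℝ)).indicator
        (fun z => gaussianPDFReal 0 1 0 * Real.exp (-l * z - z ^ 2 / 2)) z := by
    intro z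
    by_cases hz : z ∈ Set.Ioi (0 : ℝ)
    · simp only [Set.indicator_of_mem hz, gaussianPDFReal_zero_one, smul_eq_mul, mul_assoc,
        ← Real.exp_add]
      congr 2; ring
    · simp [Set.indicator_of_notMem hz]
  simp_rw [this]
  rw [integral_indicator measurableSet_Ioi, integral_const_mul, mills]

/-! ### The Stein equation for half lines -/

/-- The bounded solution `f` of `f' w - w * f w = 1_{w ≤ z} - Φ z`. -/
noncomputable def steinSol (z w : ℝ) : ℝ :=
  if w ≤ z then (1 - cdf (gaussianReal 0 1) z) * mills (-w) else cdf (gaussianReal 0 1) z * mills w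

/-- The derivative of `steinSol z` (its left derivative at `z`). -/
noncomputable def steinDeriv (z w : ℝ) : ℝ :=
  w * steinSol z w + (Set.Iic z).indicator 1 w - cdf (gaussianReal 0 1) z

/-- For `w ≤ 0` the prefactor is at most one. For `w ≥ 0` replace `z` by `w` in the prefactor; at
the threshold the two branches of the Stein solution agree, and the other branch has a prefactor at
most one. -/
theorem steinSol_left_le {z w : ℝ} (h : w ≤ z) :
    (1 - cdf (gaussianReal 0 1) z) * mills (-w) ≤ mills |w| := by
  have h0 : cdf (gaussianReal 0 1) w ≤ cdf (gaussianReal 0 1) z := monotone_cdf _ h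
  rcases le_total w 0 with hw | hw
  · rw [abs_of_nonpos hw]
    have := cdf_nonneg (gaussianReal 0 1) z
    nlinarith [mills_pos (-w)]
  · rw [abs_of_nonneg hw]
    calc (1 - cdf (gaussianReal 0 1) z) * mills (-w)
        ≤ (1 - cdf (gaussianReal 0 1) w) * mills (-w) := by
          gcongr; exact (mills_pos _).le
      _ = cdf (gaussianReal 0 1) w * mills w := by
          rw [one_sub_cdf_gaussianReal, cdf_gaussianReal_eq]; ring
      _ ≤ 1 * mills w := by gcongr; exacts [(mills_pos _).le, cdf_le_one _ _]
      _ = mills w := one_mul _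

theorem steinSol_right_le {z w : ℝ} (h : z ≤ w) :
    cdf (gaussianReal 0 1) z * mills w ≤ mills |w| := by
  have := steinSol_left_le (neg_le_neg h)
  rwa [cdf_gaussianReal_neg, sub_sub_cancel, neg_neg, abs_neg] at this

theorem steinSol_nonneg (z w : ℝ) : 0 ≤ steinSol z w := by
  unfold steinSol
  split_ifs
  · exact mul_nonneg (sub_nonneg.2 (cdf_le_one _ _)) (mills_pos _).le
  · exact mul_nonneg (cdf_nonneg _ _) (mills_pos _).le

theorem steinSol_le_mills (z w : ℝ) : steinSol z w ≤ mills |w| := by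
  unfold steinSol
  split_ifs with h
  · exact steinSol_left_le h
  · exact steinSol_right_le (not_le.1 h).le

theorem abs_steinSol_le (z w : ℝ) : |steinSol z w| ≤ 2 := by
  rw [abs_of_nonneg (steinSol_nonneg z w)]
  exact (steinSol_le_mills z w).trans ((mills_antitone (abs_nonneg w)).trans mills_zero_le)

theorem abs_mul_steinSol_le (z w : ℝ) : |w * steinSol z w| ≤ 1 := by
  rw [abs_mul, abs_of_nonneg (steinSol_nonneg z w)]
  exact (mul_le_mul_of_nonneg_left (steinSol_le_mills z w) (abs_nonneg w)).trans
    (mul_mills_le_one (abs_nonneg w))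

theorem steinSol_of_ge {z w : ℝ} (h : z ≤ w) :
    steinSol z w = cdf (gaussianReal 0 1) z * mills w := by
  unfold steinSol
  split_ifs with h1
  · obtain rfl := le_antisymm h h1
    rw [one_sub_cdf_gaussianReal, cdf_gaussianReal_eq]; ring
  · rfl

theorem hasDerivAt_stein_left (z w : ℝ) :
    HasDerivAt (fun w => (1 - cdf (gaussianReal 0 1) z) * mills (-w))
      (w * ((1 - cdf (gaussianReal 0 1) z) * mills (-w)) + (1 - cdf (gaussianReal 0 1) z)) w := by
  have := ((hasDerivAt_mills (-w)).comp w (hasDerivAt_neg w)).const_mul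
    (1 - cdf (gaussianReal 0 1) z)
  refine this.congr_deriv ?_
  ring

theorem hasDerivAt_stein_right (z w : ℝ) :
    HasDerivAt (fun w => cdf (gaussianReal 0 1) z * mills w)
      (w * (cdf (gaussianReal 0 1) z * mills w) - cdf (gaussianReal 0 1) z) w := by
  refine ((hasDerivAt_mills w).const_mul (cdf (gaussianReal 0 1) z)).congr_deriv ?_
  ring

theorem steinDeriv_of_le {z w : ℝ} (h : w ≤ z) : steinDeriv z w =
    w * ((1 - cdf (gaussianReal 0 1) z) * mills (-w)) + (1 - cdf (gaussianReal 0 1) z) := by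
  simp only [steinDeriv, steinSol, if_pos h, Set.indicator_of_mem (Set.mem_Iic.2 h), Pi.one_apply]
  ring

theorem steinDeriv_of_gt {z w : ℝ} (h : z < w) : steinDeriv z w =
    w * (cdf (gaussianReal 0 1) z * mills w) - cdf (gaussianReal 0 1) z := by
  simp only [steinDeriv, steinSol, if_neg (not_le.2 h),
    Set.indicator_of_notMem (fun h' => not_le.2 h (Set.mem_Iic.1 h'))]
  ring

theorem abs_steinDeriv_le (z w : ℝ) : |steinDeriv z w| ≤ 2 := by
  have h1 := abs_le.1 (abs_mul_steinSol_le z w)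
  have h2 := cdf_nonneg (gaussianReal 0 1) z
  have h3 := cdf_le_one (gaussianReal 0 1) z
  unfold steinDeriv
  rw [abs_le]
  by_cases h : w ∈ Set.Iic z
  · rw [Set.indicator_of_mem h, Pi.one_apply]; constructor <;> linarith
  · rw [Set.indicator_of_notMem h]; constructor <;> linarith

theorem steinSol_sub_of_le {z a b : ℝ} (ha : a ≤ z) (hb : b ≤ z) :
    |steinSol z b - steinSol z a| ≤ 2 * |b - a| := by
  have := (convex_Iic z).norm_image_sub_le_of_norm_hasDerivWithin_le (C := 2)
    (fun w _ => (hasDerivAt_stein_left z w).hasDerivWithinAt)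
    (fun w hw => by
      rw [← steinDeriv_of_le hw]; exact abs_steinDeriv_le z w) ha hb
  simpa [steinSol, ha, hb] using this

theorem steinSol_sub_of_ge {z a b : ℝ} (ha : z ≤ a) (hb : z ≤ b) :
    |steinSol z b - steinSol z a| ≤ 2 * |b - a| := by
  have := (convex_Ici z).norm_image_sub_le_of_norm_hasDerivWithin_le (C := 2)
    (fun w _ => (hasDerivAt_stein_right z w).hasDerivWithinAt)
    (fun w hw => by
      have h1 := abs_le.1 (abs_mul_steinSol_le z w)
      rw [steinSol_of_ge hw] at h1
      have h2 := cdf_nonneg (gaussianReal 0 1) z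
      have h3 := cdf_le_one (gaussianReal 0 1) z
      rw [Real.norm_eq_abs, abs_le]
      constructor <;> linarith) ha hb
  simpa [steinSol_of_ge ha, steinSol_of_ge hb] using this

theorem abs_steinSol_sub_le (z a b : ℝ) : |steinSol z b - steinSol z a| ≤ 2 * |b - a| := by
  wlog hab : a ≤ b generalizing a b
  · rw [abs_sub_comm, abs_sub_comm b]; exact this b a (not_le.1 hab).le
  rcases le_total b z with hb | hb
  · exact steinSol_sub_of_le (hab.trans hb) hb
  rcases le_total z a with ha | ha
  · exact steinSol_sub_of_ge ha hb
  have h1 := steinSol_sub_of_le ha le_rfl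
  have h2 := steinSol_sub_of_ge le_rfl hb
  have h3 := abs_add_le (steinSol z b - steinSol z z) (steinSol z z - steinSol z a)
  rw [sub_add_sub_cancel] at h3
  rw [abs_of_nonneg (sub_nonneg.2 ha)] at h1
  rw [abs_of_nonneg (sub_nonneg.2 hb)] at h2
  rw [abs_of_nonneg (sub_nonneg.2 hab)]
  linarith

theorem continuous_steinSol (z : ℝ) : Continuous (steinSol z) :=
  (LipschitzWith.of_dist_le_mul (K := 2) fun a b => by
    simpa [Real.dist_eq] using abs_steinSol_sub_le z b a).continuous

theorem measurable_steinDeriv (z : ℝ) : Measurable (steinDeriv z) :=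
  ((measurable_id.mul (continuous_steinSol z).measurable).add
    (measurable_one.indicator measurableSet_Iic)).sub measurable_const

theorem abs_mul_steinSol_sub_le (z w y : ℝ) :
    |(w + y) * steinSol z (w + y) - w * steinSol z w| ≤ 2 * (|w| + 1) * |y| := by
  have h : (w + y) * steinSol z (w + y) - w * steinSol z w =
    w * (steinSol z (w + y) - steinSol z w) + y * steinSol z (w + y) := by ring
  have h1 := abs_steinSol_sub_le z w (w + y)
  rw [add_sub_cancel_left] at h1
  calc _ ≤ |w| * |steinSol z (w + y) - steinSol z w| + |y| * |steinSol z (w + y)| := by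
        rw [h, ← abs_mul, ← abs_mul]; exact abs_add_le _ _
    _ ≤ |w| * (2 * |y|) + |y| * 2 := by gcongr; exact abs_steinSol_le _ _
    _ = _ := by ring

/-- By the Stein equation the derivative is `w * steinSol z w` plus a step function. The first part
varies smoothly; the step contributes only if the segment from `w` to `w + x` reaches `z`. -/
theorem abs_steinDeriv_sub_le (z w x : ℝ) :
    |steinDeriv z (w + x) - steinDeriv z w| ≤
      2 * (|w| + 1) * |x| + if |w - z| ≤ |x| then 1 else 0 := by
  have h1 := abs_mul_steinSol_sub_le z w x
  have h2 : |(Set.Iic z).indicator (1 : ℝ → ℝ) (w + x) - (Set.Iic z).indicator 1 w| ≤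
      if |w - z| ≤ |x| then 1 else 0 := by
    simp only [Set.indicator_apply, Set.mem_Iic, Pi.one_apply]
    have hx := le_abs_self x
    have hx' := neg_abs_le x
    have hc : (w + x ≤ z ↔ w ≤ z) ∨ |w - z| ≤ |x| := by
      by_contra! hcon
      obtain ⟨h3, h4⟩ := hcon
      rcases h3 with ⟨a, b⟩ | ⟨a, b⟩
      · rw [abs_of_pos (sub_pos.2 b)] at h4; linarith
      · rw [abs_of_nonpos (sub_nonpos.2 b)] at h4; linarith
    rcases hc with hc | hc
    · simp only [hc, sub_self, abs_zero]
      split_ifs <;> norm_num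
    · rw [if_pos hc]
      split_ifs <;> norm_num
  have h3 : steinDeriv z (w + x) - steinDeriv z w =
      ((w + x) * steinSol z (w + x) - w * steinSol z w) +
      ((Set.Iic z).indicator (1 : ℝ → ℝ) (w + x) - (Set.Iic z).indicator 1 w) := by
    unfold steinDeriv; ring
  rw [h3]
  exact (abs_add_le _ _).trans (add_le_add h1 h2)

/-- If the segment may cross the kink at `z`, the Lipschitz bound and the derivative bound
contribute `2 |x|` each. Otherwise the solution is differentiable along the segment and the
increment of its derivative is linear in `|x|`. -/
theorem abs_steinSol_taylor_le (z w x : ℝ) :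
    |steinSol z (w + x) - steinSol z w - x * steinDeriv z w| ≤
      2 * (|w| + 1) * x ^ 2 + if |w - z| ≤ |x| then 4 * |x| else 0 := by
  split_ifs with h
  · have h1 := abs_steinSol_sub_le z w (w + x)
    rw [add_sub_cancel_left] at h1
    have h2 : |x * steinDeriv z w| ≤ |x| * 2 := by
      rw [abs_mul]; gcongr; exact abs_steinDeriv_le z w
    have h3 := abs_sub (steinSol z (w + x) - steinSol z w) (x * steinDeriv z w)
    have h4 : 0 ≤ 2 * (|w| + 1) * x ^ 2 := by positivity
    linarith
  · rw [not_le] at h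
    have hb : ∀ y ∈ Set.uIcc 0 x, |y| ≤ |x| := fun y hy => by
      simpa using Set.abs_sub_left_of_mem_uIcc hy
    have hd : ∀ y ∈ Set.uIcc 0 x, |steinDeriv z (w + y) - steinDeriv z w| ≤
        2 * (|w| + 1) * |x| := fun y hy => by
      have := abs_steinDeriv_sub_le z w y
      rw [if_neg (not_le.2 ((hb y hy).trans_lt h)), add_zero] at this
      exact this.trans (by gcongr 2 * (|w| + 1) * ?_; exact hb y hy)
    have key : ∀ y ∈ Set.uIcc 0 x, HasDerivWithinAt
        (fun y => steinSol z (w + y) - y * steinDeriv z w)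
        (steinDeriv z (w + y) - steinDeriv z w) (Set.uIcc 0 x) y := by
      intro y hy
      have h2 : HasDerivWithinAt (fun y => steinSol z (w + y)) (steinDeriv z (w + y))
          (Set.uIcc 0 x) y := by
        rcases le_total w z with hw | hw
        · have hl : ∀ y ∈ Set.uIcc 0 x, w + y ≤ z := fun y hy => by
            have h5 := hb y hy
            rw [abs_of_nonpos (sub_nonpos.2 hw)] at h
            linarith [le_abs_self y]
          rw [steinDeriv_of_le (hl y hy)]
          have h3 := ((hasDerivAt_stein_left z (w + y)).comp_const_add w y).hasDerivWithinAt
            (s := Set.uIcc 0 x)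
          refine h3.congr (fun v hv => ?_) ?_
          · simp [steinSol, hl v hv]
          · simp [steinSol, hl y hy]
        · have hl : ∀ y ∈ Set.uIcc 0 x, z < w + y := fun y hy => by
            have h5 := hb y hy
            rw [abs_of_nonneg (sub_nonneg.2 hw)] at h
            linarith [neg_abs_le y]
          rw [steinDeriv_of_gt (hl y hy)]
          have h3 := ((hasDerivAt_stein_right z (w + y)).comp_const_add w y).hasDerivWithinAt
            (s := Set.uIcc 0 x)
          refine h3.congr (fun v hv => ?_) ?_
          · simp [steinSol, not_le.2 (hl v hv)]
          · simp [steinSol, not_le.2 (hl y hy)]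
      refine (h2.fun_sub ((hasDerivWithinAt_id y _).mul_const (steinDeriv z w))).congr_deriv ?_
      rw [one_mul]
    have h5 := (convex_uIcc 0 x).norm_image_sub_le_of_norm_hasDerivWithin_le key
      (fun y hy => hd y hy) Set.left_mem_uIcc Set.right_mem_uIcc
    simp only [add_zero, zero_mul, sub_zero, Real.norm_eq_abs] at h5
    have h6 : 2 * (|w| + 1) * |x| * |x| = 2 * (|w| + 1) * x ^ 2 := by
      rw [mul_assoc, abs_mul_abs_self, sq]
    rw [h6] at h5
    rw [add_zero]
    convert h5 using 2
    ring

/-! ### Sums of independent centred variables and leave-one-out sums -/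

section Independence

variable {Ω ι : Type*} [MeasurableSpace Ω] {μ : Measure Ω}

theorem indepFun_sum_erase [DecidableEq ι] {ξ : ι → Ω → ℝ} (hm : ∀ i, Measurable (ξ i))
    (hind : iIndepFun ξ μ) (s : Finset ι) (i : ι) :
    IndepFun (fun ω => ∑ j ∈ s.erase i, ξ j ω) (ξ i) μ := by
  have := hind.indepFun_finsetSum_of_notMem hm (Finset.notMem_erase i s)
  convert this using 1
  ext ω; simp

omit [MeasurableSpace Ω] in
theorem sum_erase_eq_sub [DecidableEq ι] {ξ : ι → Ω → ℝ} {s : Finset ι} {i : ι} (hi : i ∈ s)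
    (ω : Ω) : ∑ j ∈ s.erase i, ξ j ω = ∑ j ∈ s, ξ j ω - ξ i ω := by
  rw [← Finset.add_sum_erase s _ hi]; ring

variable [IsProbabilityMeasure μ]

theorem integrable_of_memLp_three {X : Ω → ℝ} (h : MemLp X 3 μ) : Integrable X μ :=
  h.integrable (by norm_num)

theorem integrable_sq_of_memLp_three {X : Ω → ℝ} (h : MemLp X 3 μ) :
    Integrable (fun ω => X ω ^ 2) μ :=
  (h.mono_exponent (p := 2) (by norm_num)).integrable_sq

omit [IsProbabilityMeasure μ] in
theorem integrable_abs_pow_three_of_memLp {X : Ω → ℝ} (h : MemLp X 3 μ) :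
    Integrable (fun ω => |X ω| ^ 3) μ := by
  simpa using h.integrable_norm_pow (p := 3) (by norm_num)

theorem integral_sq_sum {ξ : ι → Ω → ℝ} (hind : iIndepFun ξ μ) (h3 : ∀ i, MemLp (ξ i) 3 μ)
    (h0 : ∀ i, ∫ ω, ξ i ω ∂μ = 0) (s : Finset ι) :
    ∫ ω, (∑ i ∈ s, ξ i ω) ^ 2 ∂μ = ∑ i ∈ s, ∫ ω, ξ i ω ^ 2 ∂μ := by
  have h2 : ∀ i, MemLp (ξ i) 2 μ := fun i => (h3 i).mono_exponent (by norm_num)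
  have h := IndepFun.variance_sum (s := s) (fun i _ => h2 i) (fun i _ j _ hij => hind.indepFun hij)
  have hz : ∀ i, variance (ξ i) μ = ∫ ω, ξ i ω ^ 2 ∂μ := fun i =>
    variance_of_integral_eq_zero (h3 i).aemeasurable (h0 i)
  have hs : variance (∑ i ∈ s, ξ i) μ = ∫ ω, (∑ i ∈ s, ξ i ω) ^ 2 ∂μ := by
    rw [variance_of_integral_eq_zero]
    · simp
    · exact (memLp_finsetSum' s fun i _ => h2 i).aemeasurable
    · simp only [Finset.sum_apply]
      rw [integral_finsetSum _ fun i _ => integrable_of_memLp_three (h3 i)]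
      exact Finset.sum_eq_zero fun i _ => h0 i
  rw [← hs, h]
  exact Finset.sum_congr rfl fun i _ => hz i

theorem integral_abs_sum_le_one {ξ : ι → Ω → ℝ} (hind : iIndepFun ξ μ) (h3 : ∀ i, MemLp (ξ i) 3 μ)
    (h0 : ∀ i, ∫ ω, ξ i ω ∂μ = 0) {s : Finset ι} (hv : ∑ i ∈ s, ∫ ω, ξ i ω ^ 2 ∂μ ≤ 1) :
    ∫ ω, |∑ i ∈ s, ξ i ω| ∂μ ≤ 1 := by
  have h := memLp_finsetSum s fun i _ => h3 i
  have hsq := integrable_sq_of_memLp_three h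
  -- Pointwise `|S| ≤ (1 + S²) / 2`, so the second moment alone gives the bound.
  calc ∫ ω, |∑ i ∈ s, ξ i ω| ∂μ ≤ ∫ ω, (1 / 2 + (∑ i ∈ s, ξ i ω) ^ 2 * (1 / 2)) ∂μ := by
        refine integral_mono (integrable_of_memLp_three h).abs
          ((integrable_const _).add (hsq.mul_const _)) fun ω => ?_
        have := sq_nonneg (|∑ i ∈ s, ξ i ω| - 1)
        have h' := sq_abs (∑ i ∈ s, ξ i ω)
        simp only
        nlinarith
    _ ≤ 1 := by
        rw [integral_add (integrable_const _) (hsq.mul_const _), integral_mul_const,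
          integral_sq_sum hind h3 h0]
        simp
        linarith

end Independence

/-! ### A concentration inequality -/

section Concentration

/-- The identity, centred at `m` and clipped at height `l`. -/
noncomputable def clip (m l w : ℝ) : ℝ := max (-l) (min l (w - m))

theorem continuous_clip (m l : ℝ) : Continuous (clip m l) := by
  unfold clip; fun_prop

theorem abs_clip_le {m l : ℝ} (hl : 0 ≤ l) (w : ℝ) : |clip m l w| ≤ l := by
  unfold clip
  rw [abs_le]
  exact ⟨le_max_left _ _, max_le (by linarith) (min_le_left _ _)⟩

theorem monotone_clip (m l : ℝ) : Monotone (clip m l) := fun x y h => by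
  unfold clip; gcongr

theorem mul_clip_sub_nonneg (m l w x : ℝ) : 0 ≤ x * (clip m l w - clip m l (w - x)) := by
  rcases le_total 0 x with hx | hx
  · exact mul_nonneg hx (sub_nonneg.2 (monotone_clip m l (by linarith)))
  · exact mul_nonneg_of_nonpos_of_nonpos hx (sub_nonpos.2 (monotone_clip m l (by linarith)))

/-- The clipping height leaves a margin `d` around `[a, b]` on which the function still has slope
one, so a shift by `x` moves its value by at least `min d |x|` in the direction of the shift. -/
theorem le_mul_clip_sub {a b d w : ℝ} (hd : 0 ≤ d) (ha : a ≤ w) (hb : w ≤ b) (x : ℝ) :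
    |x| * min d |x| ≤
      x * (clip ((a + b) / 2) ((b - a) / 2 + d) w - clip ((a + b) / 2) ((b - a) / 2 + d) (w - x)) := by
  have h1 : clip ((a + b) / 2) ((b - a) / 2 + d) w = w - (a + b) / 2 := by
    unfold clip
    rw [min_eq_right (by linarith), max_eq_right (by linarith)]
  rw [h1]
  rcases le_total 0 x with hx | hx
  · rw [abs_of_nonneg hx]
    refine mul_le_mul_of_nonneg_left ?_ hx
    unfold clip
    rw [min_eq_right (a := (b - a) / 2 + d) (by linarith)]
    rcases le_total (-((b - a) / 2 + d)) (w - x - (a + b) / 2) with h | h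
    · rw [max_eq_right h]; exact (min_le_right _ _).trans (by linarith)
    · rw [max_eq_left h]; exact (min_le_left _ _).trans (by linarith)
  · rw [abs_of_nonpos hx, neg_mul, ← mul_neg]
    refine mul_le_mul_of_nonpos_left ?_ hx
    unfold clip
    rw [max_eq_right (a := -((b - a) / 2 + d)) (le_min (by linarith) (by linarith))]
    rcases le_total ((b - a) / 2 + d) (w - x - (a + b) / 2) with h | h
    · rw [min_eq_left h]; have := min_le_left d (-x); linarith
    · rw [min_eq_right h]; have := min_le_right d (-x); linarith

/-- For `|x| ≥ d` the difference of the two sides is a multiple of `(|x|/2 - d)²`. The loss is a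
third moment divided by `4 d`, which a third-moment sum at most `d` keeps below `1/4`. -/
theorem sq_sub_le_mul_min {d : ℝ} (hd : 0 < d) (x : ℝ) :
    x ^ 2 - |x| ^ 3 / (4 * d) ≤ |x| * min d |x| := by
  have hx := abs_nonneg x
  rw [← sq_abs x]
  rcases le_total d |x| with h | h
  · rw [min_eq_left h]
    have h2 : |x| ^ 2 - |x| ^ 3 / (4 * d) = |x| * d - |x| * (|x| / 2 - d) ^ 2 / d := by
      field_simp; ring
    rw [h2]
    have : 0 ≤ |x| * (|x| / 2 - d) ^ 2 / d := by positivity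
    linarith
  · rw [min_eq_right h]
    have : 0 ≤ |x| ^ 3 / (4 * d) := by positivity
    nlinarith

variable {Ω ι : Type*} [MeasurableSpace Ω] {μ : Measure Ω} [IsProbabilityMeasure μ]

theorem abs_mul_min_sq_le {d : ℝ} (hd : 0 ≤ d) (x : ℝ) : (|x| * min d |x|) ^ 2 ≤ d ^ 2 * x ^ 2 := by
  rw [mul_pow, sq_abs, mul_comm]
  have h1 : 0 ≤ min d |x| := le_min hd (abs_nonneg x)
  gcongr
  exact min_le_left _ _

theorem integral_abs_sub_integral_le {X : Ω → ℝ} (hX : MemLp X 2 μ) {d : ℝ} (hd : 0 < d)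
    (h : variance X μ ≤ d ^ 2) : ∫ ω, |X ω - ∫ ω', X ω' ∂μ| ∂μ ≤ d := by
  have hX' : MemLp (fun ω => X ω - ∫ ω', X ω' ∂μ) 2 μ := hX.sub (memLp_const _)
  have hsq := hX'.integrable_sq
  calc ∫ ω, |X ω - ∫ ω', X ω' ∂μ| ∂μ ≤ ∫ ω, (d / 2 + (X ω - ∫ ω', X ω' ∂μ) ^ 2 * (1 / (2 * d))) ∂μ := by
        refine integral_mono (hX'.integrable (by norm_num)).abs
          ((integrable_const _).add (hsq.mul_const _)) fun ω => ?_
        have h1 := sq_nonneg (|X ω - ∫ ω', X ω' ∂μ| - d)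
        have h2 := sq_abs (X ω - ∫ ω', X ω' ∂μ)
        simp only
        rw [← h2, ← sub_nonneg]
        have : d / 2 + |X ω - ∫ ω', X ω' ∂μ| ^ 2 * (1 / (2 * d)) - |X ω - ∫ ω', X ω' ∂μ| =
          (|X ω - ∫ ω', X ω' ∂μ| - d) ^ 2 / (2 * d) := by field_simp; ring
        rw [this]; positivity
    _ = d / 2 + variance X μ * (1 / (2 * d)) := by
        rw [integral_add (integrable_const _) (hsq.mul_const _), integral_mul_const,
          variance_eq_integral hX.aemeasurable]
        simp
    _ ≤ d / 2 + d ^ 2 * (1 / (2 * d)) := by gcongr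
    _ = d := by field_simp; ring

/-- Sums of independent centred variables put little mass on short intervals. -/
theorem concentration {ξ : ι → Ω → ℝ} (hm : ∀ i, Measurable (ξ i)) (hind : iIndepFun ξ μ)
    (h3 : ∀ i, MemLp (ξ i) 3 μ) (h0 : ∀ i, ∫ ω, ξ i ω ∂μ = 0) {s : Finset ι} {d : ℝ} (hd : 0 < d)
    (hγ : ∑ i ∈ s, ∫ ω, |ξ i ω| ^ 3 ∂μ ≤ d) (hv : 1 / 2 ≤ ∑ i ∈ s, ∫ ω, ξ i ω ^ 2 ∂μ)
    (hv1 : ∑ i ∈ s, ∫ ω, ξ i ω ^ 2 ∂μ ≤ 1) {a b : ℝ} (hab : a ≤ b) :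
    μ.real {ω | a ≤ ∑ i ∈ s, ξ i ω ∧ ∑ i ∈ s, ξ i ω ≤ b} ≤ 2 * (b - a) + 8 * d := by
  classical
  set S : Ω → ℝ := fun ω => ∑ i ∈ s, ξ i ω with hS
  have hSm : Measurable S := Finset.measurable_fun_sum s fun i _ => hm i
  set A : Set Ω := {ω | a ≤ S ω ∧ S ω ≤ b} with hA
  have hAm : MeasurableSet A :=
    (measurableSet_le measurable_const hSm).inter (measurableSet_le hSm measurable_const)
  set m := (a + b) / 2
  set l := (b - a) / 2 + d with hl
  have hl0 : 0 ≤ l := by rw [hl]; linarith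
  set g := clip m l
  have hg : Continuous g := continuous_clip m l
  set η : ι → Ω → ℝ := fun i ω => |ξ i ω| * min d |ξ i ω| with hη
  have hφ : Measurable fun x : ℝ => |x| * min d |x| := by fun_prop
  have hηm : ∀ i, Measurable (η i) := fun i => hφ.comp (hm i)
  have hη2 : ∀ i, MemLp (η i) 2 μ := by
    intro i
    refine (((h3 i).mono_exponent (p := 2) (by norm_num)).const_mul d).mono
      (hηm i).aestronglyMeasurable (ae_of_all _ fun ω => ?_)
    have := abs_mul_min_sq_le hd.le (ξ i ω)
    rw [Real.norm_eq_abs, Real.norm_eq_abs]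
    exact sq_le_sq.1 (by rw [mul_pow d]; exact this)
  have hηi : ∀ i, Integrable (η i) μ := fun i => (hη2 i).integrable (by norm_num)
  have hξi := fun i => integrable_of_memLp_three (h3 i)
  have hSi : Integrable S μ := integrable_finsetSum s fun i _ => hξi i
  have hbdd : ∀ i (T : Ω → ℝ), Measurable T → Integrable (fun ω => ξ i ω * g (T ω)) μ := by
    intro i T hT
    exact (hξi i).mul_bdd (c := l) (hg.measurable.comp hT).aestronglyMeasurable
      (ae_of_all _ fun ω => abs_clip_le hl0 _)
  -- the upper bound for `E[S g(S)]`
  have hup : ∫ ω, S ω * g (S ω) ∂μ ≤ l := by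
    calc ∫ ω, S ω * g (S ω) ∂μ ≤ ∫ ω, |S ω| * l ∂μ := by
          refine integral_mono (hSi.mul_bdd (c := l) (hg.measurable.comp hSm).aestronglyMeasurable
            (ae_of_all _ fun ω => abs_clip_le hl0 _)) (hSi.abs.mul_const l) fun ω => ?_
          exact (le_abs_self _).trans (by
            rw [abs_mul]; exact mul_le_mul_of_nonneg_left (abs_clip_le hl0 _) (abs_nonneg _))
      _ ≤ l := by
          rw [integral_mul_const]
          nlinarith [integral_abs_sum_le_one hind h3 h0 hv1]
  -- the lower bound
  have hlow : ∫ ω, A.indicator (fun ω => ∑ i ∈ s, η i ω) ω ∂μ ≤ ∫ ω, S ω * g (S ω) ∂μ := by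
    have e1 : ∀ ω, S ω * g (S ω) = ∑ i ∈ s, ξ i ω * g (S ω) := fun ω => by
      rw [hS, Finset.sum_mul]
    have e2 : ∀ ω, A.indicator (fun ω => ∑ i ∈ s, η i ω) ω = ∑ i ∈ s, A.indicator (η i) ω :=
      fun ω => by
        by_cases hω : ω ∈ A <;> simp [hω]
    simp_rw [e1, e2]
    rw [integral_finsetSum _ fun i _ => (hηi i).indicator hAm,
      integral_finsetSum _ fun i _ => hbdd i S hSm]
    refine Finset.sum_le_sum fun i hi => ?_
    have hT : Measurable (fun ω => ∑ j ∈ s.erase i, ξ j ω) :=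
      Finset.measurable_fun_sum _ fun i _ => hm i
    have hz : ∫ ω, ξ i ω * g (∑ j ∈ s.erase i, ξ j ω) ∂μ = 0 := by
      have := ((indepFun_sum_erase hm hind s i).symm.integral_fun_comp_mul_comp
        (f := id) (g := g) (hm i).aemeasurable hT.aemeasurable
        measurable_id.aestronglyMeasurable hg.measurable.aestronglyMeasurable)
      simp only [id] at this
      rw [this, h0 i, zero_mul]
    rw [← sub_zero (∫ ω, ξ i ω * g (S ω) ∂μ), ← hz,
      ← integral_sub (hbdd i S hSm) (hbdd i _ hT)]
    refine integral_mono ((hηi i).indicator hAm) ((hbdd i S hSm).sub (hbdd i _ hT)) fun ω => ?_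
    simp only [sum_erase_eq_sub hi, ← mul_sub]
    by_cases hω : ω ∈ A
    · rw [Set.indicator_of_mem hω]
      exact le_mul_clip_sub hd.le hω.1 hω.2 _
    · rw [Set.indicator_of_notMem hω]
      exact mul_clip_sub_nonneg _ _ _ _
  -- moments of `η`
  have hE : 1 / 4 ≤ ∫ ω, ∑ i ∈ s, η i ω ∂μ := by
    rw [integral_finsetSum _ fun i _ => hηi i]
    have h1 : ∀ i, ∫ ω, ξ i ω ^ 2 ∂μ - (∫ ω, |ξ i ω| ^ 3 ∂μ) / (4 * d) ≤ ∫ ω, η i ω ∂μ := by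
      intro i
      have i1 := integrable_sq_of_memLp_three (h3 i)
      have i2 := (integrable_abs_pow_three_of_memLp (h3 i)).div_const (4 * d)
      rw [← integral_div, ← integral_sub i1 i2]
      exact integral_mono (i1.sub i2) (hηi i) fun ω => sq_sub_le_mul_min hd _
    have h2 := Finset.sum_le_sum fun i (_ : i ∈ s) => h1 i
    rw [Finset.sum_sub_distrib, ← Finset.sum_div] at h2
    have h4 : (∑ i ∈ s, ∫ ω, |ξ i ω| ^ 3 ∂μ) / (4 * d) ≤ 1 / 4 := by
      rw [div_le_iff₀ (by positivity)]; linarith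
    linarith
  have hη2s : MemLp (fun ω => ∑ i ∈ s, η i ω) 2 μ := memLp_finsetSum s fun i _ => hη2 i
  have hvar : variance (fun ω => ∑ i ∈ s, η i ω) μ ≤ d ^ 2 := by
    have hindη : iIndepFun η μ := hind.comp (fun _ x => |x| * min d |x|) fun _ => hφ
    have h := IndepFun.variance_sum (s := s) (fun i _ => hη2 i)
      (fun i _ j _ hij => hindη.indepFun hij)
    have e : (∑ i ∈ s, η i) = fun ω => ∑ i ∈ s, η i ω := by ext; simp
    rw [e] at h
    rw [h]
    calc ∑ i ∈ s, variance (η i) μ ≤ ∑ i ∈ s, d ^ 2 * ∫ ω, ξ i ω ^ 2 ∂μ := by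
          refine Finset.sum_le_sum fun i _ => ?_
          refine (variance_le_expectation_sq (hηm i).aestronglyMeasurable).trans ?_
          rw [← integral_const_mul]
          exact integral_mono (hη2 i).integrable_sq
            ((integrable_sq_of_memLp_three (h3 i)).const_mul _)
            fun ω => abs_mul_min_sq_le hd.le _
      _ ≤ d ^ 2 := by
          rw [← Finset.mul_sum]; nlinarith [sq_nonneg d]
  have hdev := integral_abs_sub_integral_le hη2s hd hvar
  set e := ∫ ω, ∑ i ∈ s, η i ω ∂μ with he
  have hηs : Integrable (fun ω => ∑ i ∈ s, η i ω) μ := hη2s.integrable (by norm_num)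
  have hfin : μ.real A * (1 / 4) - ∫ ω, |∑ i ∈ s, η i ω - e| ∂μ ≤
      ∫ ω, A.indicator (fun ω => ∑ i ∈ s, η i ω) ω ∂μ := by
    have i1 : Integrable (A.indicator fun _ => (1 / 4 : ℝ)) μ := (integrable_const _).indicator hAm
    have i2 : Integrable (fun ω => |∑ i ∈ s, η i ω - e|) μ :=
      (hηs.sub (integrable_const _)).abs
    have h1 : ∫ ω, A.indicator (fun _ => (1 / 4 : ℝ)) ω ∂μ = μ.real A * (1 / 4) := by
      rw [integral_indicator hAm]; simp
    rw [← h1, ← integral_sub i1 i2]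
    refine integral_mono (i1.sub i2) (hηs.indicator hAm) fun ω => ?_
    by_cases hω : ω ∈ A
    · simp only [Set.indicator_of_mem hω]
      linarith [neg_abs_le (∑ i ∈ s, η i ω - e)]
    · simp only [Set.indicator_of_notMem hω]
      linarith [abs_nonneg (∑ i ∈ s, η i ω - e)]
  -- The collected bounds read `μ(A) / 4 - d ≤ E[S g(S)] ≤ (b - a) / 2 + d`.
  linarith

end Concentration

/-! ### The Berry-Esseen theorem by Stein's method -/

section BerryEsseen

variable {Ω ι : Type*} [MeasurableSpace Ω] {μ : Measure Ω} [IsProbabilityMeasure μ]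

/-- By independence and Fubini, freeze `Y = y` and apply the concentration bound for `X` at radius
`|y|`. In Stein's method `X` is the sum without one summand and `Y` that summand. -/
theorem integral_ite_abs_sub_le {X Y : Ω → ℝ} (hX : Measurable X) (hY : Measurable Y)
    (hXY : IndepFun X Y μ) {z p q : ℝ} (hc : ∀ t, 0 ≤ t → μ.real {ω | |X ω - z| ≤ t} ≤ p * t + q)
    {φ : ℝ → ℝ} (hφ : Measurable φ) (hφ0 : ∀ y, 0 ≤ φ y) (h1 : Integrable (fun ω => φ (Y ω)) μ)
    (h2 : Integrable (fun ω => φ (Y ω) * |Y ω|) μ) :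
    Integrable (fun ω => if |X ω - z| ≤ |Y ω| then φ (Y ω) else 0) μ ∧
    ∫ ω, (if |X ω - z| ≤ |Y ω| then φ (Y ω) else 0) ∂μ ≤
      p * ∫ ω, φ (Y ω) * |Y ω| ∂μ + q * ∫ ω, φ (Y ω) ∂μ := by
  set G : ℝ × ℝ → ℝ := fun v => if |v.2 - z| ≤ |v.1| then φ v.1 else 0 with hG
  have hset : MeasurableSet {v : ℝ × ℝ | |v.2 - z| ≤ |v.1|} :=
    measurableSet_le (by fun_prop) (by fun_prop)
  have hGm : Measurable G := Measurable.ite hset (hφ.comp measurable_fst) measurable_const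
  have hYX : Measurable fun ω => (Y ω, X ω) := hY.prodMk hX
  have hint : Integrable (fun ω => G (Y ω, X ω)) μ := by
    refine h1.mono' (hGm.comp hYX).aestronglyMeasurable (ae_of_all _ fun ω => ?_)
    simp only [hG]
    split_ifs
    · rw [Real.norm_of_nonneg (hφ0 _)]
    · simpa using hφ0 _
  refine ⟨hint, ?_⟩
  have hmap := (indepFun_iff_map_prod_eq_prod_map_map hY.aemeasurable hX.aemeasurable).1 hXY.symm
  have hpX : IsProbabilityMeasure (μ.map X) := Measure.isProbabilityMeasure_map hX.aemeasurable
  have hpY : IsProbabilityMeasure (μ.map Y) := Measure.isProbabilityMeasure_map hY.aemeasurable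
  have hint' : Integrable G ((μ.map Y).prod (μ.map X)) := by
    rw [← hmap, integrable_map_measure hGm.aestronglyMeasurable hYX.aemeasurable]
    exact hint
  have e1 : ∫ ω, G (Y ω, X ω) ∂μ = ∫ y, ∫ x, G (y, x) ∂μ.map X ∂μ.map Y := by
    rw [← integral_prod _ hint', ← hmap, integral_map hYX.aemeasurable hGm.aestronglyMeasurable]
  have hr1 : Integrable φ (μ.map Y) := by
    rw [integrable_map_measure hφ.aestronglyMeasurable hY.aemeasurable]; exact h1
  have hφm : Measurable fun y => φ y * |y| := by fun_prop
  have hr2 : Integrable (fun y => φ y * |y|) (μ.map Y) := by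
    rw [integrable_map_measure hφm.aestronglyMeasurable hY.aemeasurable]; exact h2
  have e2 : ∀ y, ∫ x, G (y, x) ∂μ.map X ≤ p * (φ y * |y|) + q * φ y := by
    intro y
    have hs : MeasurableSet {x : ℝ | |x - z| ≤ |y|} :=
      measurableSet_le (by fun_prop) (by fun_prop)
    have : (fun x => G (y, x)) = {x : ℝ | |x - z| ≤ |y|}.indicator fun _ => φ y := by
      ext x; simp [hG, Set.indicator_apply]
    rw [this, integral_indicator hs, setIntegral_const, map_measureReal_apply hX hs, smul_eq_mul]
    have h5 := hc |y| (abs_nonneg y)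
    have h6 : μ.real (X ⁻¹' {x | |x - z| ≤ |y|}) * φ y ≤ (p * |y| + q) * φ y :=
      mul_le_mul_of_nonneg_right h5 (hφ0 y)
    linarith
  calc ∫ ω, G (Y ω, X ω) ∂μ = ∫ y, ∫ x, G (y, x) ∂μ.map X ∂μ.map Y := e1
    _ ≤ ∫ y, (p * (φ y * |y|) + q * φ y) ∂μ.map Y :=
        integral_mono hint'.integral_prod_left ((hr2.const_mul p).add (hr1.const_mul q)) e2
    _ = _ := by
        rw [integral_add (hr2.const_mul p) (hr1.const_mul q), integral_const_mul,
          integral_const_mul, integral_map hY.aemeasurable hφm.aestronglyMeasurable,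
          integral_map hY.aemeasurable hφ.aestronglyMeasurable]

theorem sq_integral_abs_le {Y : Ω → ℝ} (hY : MemLp Y 3 μ) :
    (∫ ω, |Y ω| ∂μ) ^ 2 ≤ ∫ ω, Y ω ^ 2 ∂μ := by
  have i1 := (integrable_of_memLp_three hY).abs
  have i2 := integrable_sq_of_memLp_three hY
  set a := ∫ ω, |Y ω| ∂μ
  have h : ∫ ω, (2 * a * |Y ω| - a ^ 2) ∂μ ≤ ∫ ω, Y ω ^ 2 ∂μ := by
    refine integral_mono ((i1.const_mul _).sub (integrable_const _)) i2 fun ω => ?_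
    have := sq_nonneg (|Y ω| - a)
    have h' := sq_abs (Y ω)
    simp only
    nlinarith
  rw [integral_sub (i1.const_mul _) (integrable_const _), integral_const_mul] at h
  simp only [integral_const, probReal_univ, one_smul] at h
  nlinarith

/-- Integrate `(|Y| - a)² (|Y| + a) ≥ 0` with `a = E|Y|`. -/
theorem integral_abs_mul_integral_sq_le {Y : Ω → ℝ} (hY : MemLp Y 3 μ) :
    (∫ ω, |Y ω| ∂μ) * ∫ ω, Y ω ^ 2 ∂μ ≤ ∫ ω, |Y ω| ^ 3 ∂μ := by
  have i1 := (integrable_of_memLp_three hY).abs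
  have i2 := integrable_sq_of_memLp_three hY
  have i3 := integrable_abs_pow_three_of_memLp hY
  have h1 := sq_integral_abs_le hY
  set a := ∫ ω, |Y ω| ∂μ
  have ha : 0 ≤ a := integral_nonneg fun _ => abs_nonneg _
  have h2 : ∫ ω, (a * Y ω ^ 2 + a ^ 2 * |Y ω| - a ^ 3) ∂μ ≤ ∫ ω, |Y ω| ^ 3 ∂μ := by
    refine integral_mono (((i2.const_mul _).add (i1.const_mul _)).sub (integrable_const _)) i3
      fun ω => ?_
    have h' := sq_abs (Y ω)
    have := mul_nonneg (sq_nonneg (|Y ω| - a)) (add_nonneg (abs_nonneg (Y ω)) ha)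
    simp only
    rw [← h']
    nlinarith
  rw [integral_sub ((i2.const_mul _).fun_add (i1.const_mul _)) (integrable_const _),
    integral_add (i2.const_mul _) (i1.const_mul _), integral_const_mul, integral_const_mul] at h2
  simp only [integral_const, probReal_univ, one_smul] at h2
  have : a ^ 2 * a = a ^ 3 := by ring
  linarith

/-- Uses `(p + q)³ ≤ 4 (p³ + q³)` and `|E Y|³ ≤ E|Y|³`, the latter from the two moment inequalities
above. -/
theorem integral_abs_sub_pow_three_le {Y : Ω → ℝ} (hY : MemLp Y 3 μ) :
    ∫ ω, |Y ω - ∫ ω', Y ω' ∂μ| ^ 3 ∂μ ≤ 8 * ∫ ω, |Y ω| ^ 3 ∂μ := by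
  have i3 := integrable_abs_pow_three_of_memLp hY
  set m := ∫ ω', Y ω' ∂μ with hm
  have hY' : MemLp (fun ω => Y ω - m) 3 μ := hY.sub (memLp_const _)
  have h1 : |m| ≤ ∫ ω, |Y ω| ∂μ := abs_integral_le_integral_abs
  have h2 : |m| ^ 3 ≤ ∫ ω, |Y ω| ^ 3 ∂μ := by
    have ha : 0 ≤ ∫ ω, |Y ω| ∂μ := integral_nonneg fun _ => abs_nonneg _
    calc |m| ^ 3 ≤ (∫ ω, |Y ω| ∂μ) ^ 3 := by gcongr
      _ = (∫ ω, |Y ω| ∂μ) * (∫ ω, |Y ω| ∂μ) ^ 2 := by ring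
      _ ≤ (∫ ω, |Y ω| ∂μ) * ∫ ω, Y ω ^ 2 ∂μ :=
          mul_le_mul_of_nonneg_left (sq_integral_abs_le hY) ha
      _ ≤ _ := integral_abs_mul_integral_sq_le hY
  calc ∫ ω, |Y ω - m| ^ 3 ∂μ ≤ ∫ ω, (4 * |Y ω| ^ 3 + 4 * |m| ^ 3) ∂μ := by
        refine integral_mono (integrable_abs_pow_three_of_memLp hY')
          ((i3.const_mul 4).add (integrable_const _)) fun ω => ?_
        have h3 : |Y ω - m| ≤ |Y ω| + |m| := abs_sub _ _
        have h4 := abs_nonneg (Y ω)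
        have h5 := abs_nonneg m
        calc |Y ω - m| ^ 3 ≤ (|Y ω| + |m|) ^ 3 := by gcongr
          _ ≤ 4 * |Y ω| ^ 3 + 4 * |m| ^ 3 := by
              nlinarith [mul_nonneg (add_nonneg h4 h5) (sq_nonneg (|Y ω| - |m|))]
    _ = 4 * ∫ ω, |Y ω| ^ 3 ∂μ + 4 * |m| ^ 3 := by
        rw [integral_add (i3.const_mul 4) (integrable_const _), integral_const_mul]
        simp
    _ ≤ _ := by linarith

/-- Contribution of one summand `Y` to the Stein identity, `X` being the rest. Independence gives
`E[Y f(X)] = 0` and `E[Y² f'(X)] = E[Y²] E[f'(X)]`. What remains is the cost of replacing `X + Y` by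
`X` in the derivative, and a Taylor remainder. Near the kink both are controlled by the
concentration hypothesis on `X`. -/
theorem stein_term {X Y : Ω → ℝ} (hX : Measurable X) (hY : Measurable Y)
    (hXY : IndepFun X Y μ) (hXi : Integrable X μ) (hX1 : ∫ ω, |X ω| ∂μ ≤ 1) (hY3 : MemLp Y 3 μ)
    (hY0 : ∫ ω, Y ω ∂μ = 0) {z d : ℝ}
    (hc : ∀ t, 0 ≤ t → μ.real {ω | |X ω - z| ≤ t} ≤ 4 * t + 8 * d) :
    |(∫ ω, Y ω ^ 2 ∂μ) * ∫ ω, steinDeriv z (X ω + Y ω) ∂μ -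
        ∫ ω, Y ω * steinSol z (X ω + Y ω) ∂μ| ≤
      28 * ∫ ω, |Y ω| ^ 3 ∂μ + 40 * d * ∫ ω, Y ω ^ 2 ∂μ := by
  have i1 := integrable_of_memLp_three hY3
  have i2 := integrable_sq_of_memLp_three hY3
  have i3 := integrable_abs_pow_three_of_memLp hY3
  have hf := (continuous_steinSol z).measurable
  have hF := measurable_steinDeriv z
  have iF : ∀ T : Ω → ℝ, Measurable T → Integrable (fun ω => steinDeriv z (T ω)) μ := fun T hT =>
    (integrable_const (2 : ℝ)).mono' (hF.comp hT).aestronglyMeasurable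
      (ae_of_all _ fun ω => abs_steinDeriv_le z _)
  have iYf : ∀ T : Ω → ℝ, Measurable T → Integrable (fun ω => Y ω * steinSol z (T ω)) μ :=
    fun T hT => i1.mul_bdd (c := 2) (hf.comp hT).aestronglyMeasurable
      (ae_of_all _ fun ω => abs_steinSol_le z _)
  have iYF : Integrable (fun ω => Y ω ^ 2 * steinDeriv z (X ω)) μ :=
    i2.mul_bdd (c := 2) (hF.comp hX).aestronglyMeasurable
      (ae_of_all _ fun ω => abs_steinDeriv_le z _)
  have z1 : ∫ ω, Y ω * steinSol z (X ω) ∂μ = 0 := by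
    have := hXY.symm.integral_fun_comp_mul_comp (f := id) (g := steinSol z) hY.aemeasurable
      hX.aemeasurable measurable_id.aestronglyMeasurable hf.aestronglyMeasurable
    simp only [id] at this
    rw [this, hY0, zero_mul]
  have z2 : ∫ ω, Y ω ^ 2 * steinDeriv z (X ω) ∂μ =
      (∫ ω, Y ω ^ 2 ∂μ) * ∫ ω, steinDeriv z (X ω) ∂μ :=
    hXY.symm.integral_fun_comp_mul_comp (f := fun y => y ^ 2) (g := steinDeriv z) hY.aemeasurable
      hX.aemeasurable (by fun_prop) hF.aestronglyMeasurable
  have iX : ∀ φ : ℝ → ℝ, Measurable φ → Integrable (fun ω => φ (Y ω)) μ →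
      Integrable (fun ω => |X ω| * φ (Y ω)) μ := fun φ hφ h =>
    (hXY.comp measurable_abs hφ).integrable_mul hXi.abs h
  have eX : ∀ φ : ℝ → ℝ, Measurable φ → (∀ y, 0 ≤ φ y) → Integrable (fun ω => φ (Y ω)) μ →
      ∫ ω, 2 * (|X ω| + 1) * φ (Y ω) ∂μ ≤ 4 * ∫ ω, φ (Y ω) ∂μ := by
    intro φ hφ h0 h
    have e := hXY.integral_fun_comp_mul_comp (f := fun x => |x|) (g := φ) hX.aemeasurable
      hY.aemeasurable (by fun_prop) hφ.aestronglyMeasurable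
    have : ∀ ω, 2 * (|X ω| + 1) * φ (Y ω) = 2 * (|X ω| * φ (Y ω)) + 2 * φ (Y ω) :=
      fun ω => by ring
    simp_rw [this]
    rw [integral_add ((iX φ hφ h).const_mul 2) (h.const_mul 2), integral_const_mul,
      integral_const_mul, e]
    have : 0 ≤ ∫ ω, φ (Y ω) ∂μ := integral_nonneg fun ω => h0 (Y ω)
    nlinarith
  have iX' : ∀ φ : ℝ → ℝ, Measurable φ → Integrable (fun ω => φ (Y ω)) μ →
      Integrable (fun ω => 2 * (|X ω| + 1) * φ (Y ω)) μ := by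
    intro φ hφ h
    have : ∀ ω, 2 * (|X ω| + 1) * φ (Y ω) = 2 * (|X ω| * φ (Y ω)) + 2 * φ (Y ω) :=
      fun ω => by ring
    simp_rw [this]
    exact ((iX φ hφ h).const_mul 2).add (h.const_mul 2)
  -- replacing `X + Y` by `X` in the derivative
  have b1 : |∫ ω, (steinDeriv z (X ω + Y ω) - steinDeriv z (X ω)) ∂μ| ≤
      8 * ∫ ω, |Y ω| ∂μ + 8 * d := by
    obtain ⟨j1, j2⟩ := integral_ite_abs_sub_le hX hY hXY hc (φ := fun _ => 1) measurable_const
      (fun _ => zero_le_one) (integrable_const _) (by simpa using i1.abs)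
    have hb := iX' (fun y => |y|) (by fun_prop) i1.abs
    calc |∫ ω, (steinDeriv z (X ω + Y ω) - steinDeriv z (X ω)) ∂μ|
        ≤ ∫ ω, (2 * (|X ω| + 1) * |Y ω| + if |X ω - z| ≤ |Y ω| then 1 else 0) ∂μ :=
by
          rw [← Real.norm_eq_abs]
          exact norm_integral_le_of_norm_le (hb.fun_add j1)
            (ae_of_all _ fun ω => abs_steinDeriv_sub_le z _ _)
      _ ≤ 4 * ∫ ω, |Y ω| ∂μ + (4 * ∫ ω, |Y ω| ∂μ + 8 * d) := by
          rw [integral_add hb j1]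
          refine add_le_add (eX (fun y => |y|) (by fun_prop) abs_nonneg i1.abs) ?_
          simpa using j2
      _ = _ := by ring
  -- the Taylor remainder
  have b2 : |∫ ω, Y ω * (steinSol z (X ω + Y ω) - steinSol z (X ω) - Y ω * steinDeriv z (X ω)) ∂μ| ≤
      20 * ∫ ω, |Y ω| ^ 3 ∂μ + 32 * d * ∫ ω, Y ω ^ 2 ∂μ := by
    have e3 : ∀ ω, Y ω ^ 2 * |Y ω| = |Y ω| ^ 3 := fun ω => by rw [← sq_abs]; ring
    obtain ⟨j1, j2⟩ := integral_ite_abs_sub_le hX hY hXY hc (φ := fun y => y ^ 2) (by fun_prop)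
      (fun _ => sq_nonneg _) i2 (by simpa only [e3] using i3)
    have hb := iX' (fun y => |y| ^ 3) (by fun_prop) i3
    calc |∫ ω, Y ω * (steinSol z (X ω + Y ω) - steinSol z (X ω) - Y ω * steinDeriv z (X ω)) ∂μ|
        ≤ ∫ ω, (2 * (|X ω| + 1) * |Y ω| ^ 3 +
            4 * if |X ω - z| ≤ |Y ω| then Y ω ^ 2 else 0) ∂μ := by
          rw [← Real.norm_eq_abs]
          refine norm_integral_le_of_norm_le (hb.fun_add (j1.const_mul 4)) (ae_of_all _ fun ω => ?_)
          rw [Real.norm_eq_abs, abs_mul]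
          refine (mul_le_mul_of_nonneg_left (abs_steinSol_taylor_le z (X ω) (Y ω))
            (abs_nonneg _)).trans (le_of_eq ?_)
          rw [← sq_abs (Y ω)]
          split_ifs <;> ring
      _ ≤ 4 * ∫ ω, |Y ω| ^ 3 ∂μ +
            4 * (4 * ∫ ω, |Y ω| ^ 3 ∂μ + 8 * d * ∫ ω, Y ω ^ 2 ∂μ) := by
          rw [integral_add hb (j1.const_mul 4), integral_const_mul]
          refine add_le_add (eX (fun y => |y| ^ 3) (by fun_prop) (fun _ => by positivity) i3) ?_
          simp only [e3] at j2
          gcongr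
      _ = _ := by ring
  have hsplit : (∫ ω, Y ω ^ 2 ∂μ) * ∫ ω, steinDeriv z (X ω + Y ω) ∂μ -
        ∫ ω, Y ω * steinSol z (X ω + Y ω) ∂μ =
      (∫ ω, Y ω ^ 2 ∂μ) * ∫ ω, (steinDeriv z (X ω + Y ω) - steinDeriv z (X ω)) ∂μ -
      ∫ ω, Y ω * (steinSol z (X ω + Y ω) - steinSol z (X ω) - Y ω * steinDeriv z (X ω)) ∂μ := by
    have : ∀ ω, Y ω * (steinSol z (X ω + Y ω) - steinSol z (X ω) - Y ω * steinDeriv z (X ω)) =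
      Y ω * steinSol z (X ω + Y ω) - Y ω * steinSol z (X ω) - Y ω ^ 2 * steinDeriv z (X ω) :=
      fun ω => by ring
    simp_rw [this]
    have hXY' : Measurable fun ω => X ω + Y ω := hX.add hY
    rw [integral_sub (iF _ hXY') (iF _ hX),
      integral_sub (show Integrable (fun ω => Y ω * steinSol z (X ω + Y ω) -
        Y ω * steinSol z (X ω)) μ from (iYf _ hXY').sub (iYf _ hX)) iYF,
      integral_sub (iYf _ hXY') (iYf _ hX), z1, z2]
    ring
  have hv : 0 ≤ ∫ ω, Y ω ^ 2 ∂μ := integral_nonneg fun _ => sq_nonneg _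
  rw [hsplit]
  refine (abs_sub _ _).trans ?_
  rw [abs_mul, abs_of_nonneg hv]
  have h5 := mul_le_mul_of_nonneg_left b1 hv
  have h6 := integral_abs_mul_integral_sq_le hY3
  nlinarith

/-- The Berry-Esseen theorem for independent, not identically distributed variables. -/
theorem berry_esseen [Fintype ι] {ξ : ι → Ω → ℝ} (hm : ∀ i, Measurable (ξ i))
    (hind : iIndepFun ξ μ) (h3 : ∀ i, MemLp (ξ i) 3 μ) (h0 : ∀ i, ∫ ω, ξ i ω ∂μ = 0) {d : ℝ}
    (hd : 0 < d) (hγ : ∑ i, ∫ ω, |ξ i ω| ^ 3 ∂μ ≤ d) (hv : ∑ i, ∫ ω, ξ i ω ^ 2 ∂μ = 1)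
    (hi : ∀ i, ∫ ω, ξ i ω ^ 2 ∂μ ≤ 1 / 2) (z : ℝ) :
    |μ.real {ω | ∑ i, ξ i ω ≤ z} - cdf (gaussianReal 0 1) z| ≤ 68 * d := by
  classical
  set S : Ω → ℝ := fun ω => ∑ i, ξ i ω with hS
  have hSm : Measurable S := Finset.measurable_fun_sum _ fun i _ => hm i
  have hξi := fun i => integrable_of_memLp_three (h3 i)
  have hSi : Integrable S μ := integrable_finsetSum _ fun i _ => hξi i
  have hf := (continuous_steinSol z).measurable
  have hF := measurable_steinDeriv z
  have iF : Integrable (fun ω => steinDeriv z (S ω)) μ :=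
    (integrable_const (2 : ℝ)).mono' (hF.comp hSm).aestronglyMeasurable
      (ae_of_all _ fun ω => abs_steinDeriv_le z _)
  have iYf : ∀ Y : Ω → ℝ, Integrable Y μ → Integrable (fun ω => Y ω * steinSol z (S ω)) μ :=
    fun Y hY => hY.mul_bdd (c := 2) (hf.comp hSm).aestronglyMeasurable
      (ae_of_all _ fun ω => abs_steinSol_le z _)
  have hset : MeasurableSet {ω | S ω ≤ z} := measurableSet_le hSm measurable_const
  -- The Stein equation evaluated at `S` and integrated; unit total variance lets `E[f'(S)]` be
  -- distributed over the summands.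
  have key : μ.real {ω | S ω ≤ z} - cdf (gaussianReal 0 1) z =
      ∑ i, ((∫ ω, ξ i ω ^ 2 ∂μ) * ∫ ω, steinDeriv z (S ω) ∂μ -
        ∫ ω, ξ i ω * steinSol z (S ω) ∂μ) := by
    rw [Finset.sum_sub_distrib, ← Finset.sum_mul, hv, one_mul,
      ← integral_finsetSum _ fun i _ => iYf _ (hξi i)]
    simp_rw [← Finset.sum_mul]
    rw [← integral_sub iF (iYf S hSi)]
    have : ∀ ω, steinDeriv z (S ω) - S ω * steinSol z (S ω) =
        {ω | S ω ≤ z}.indicator (fun _ => (1 : ℝ)) ω - cdf (gaussianReal 0 1) z := by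
      intro ω
      simp only [steinDeriv, Set.indicator_apply, Set.mem_Iic, Set.mem_ofPred_eq, Pi.one_apply]
      ring
    change _ = ∫ ω, (steinDeriv z (S ω) - S ω * steinSol z (S ω)) ∂μ
    simp_rw [this]
    rw [integral_sub ((integrable_const _).indicator hset) (integrable_const _),
      integral_indicator hset]
    simp
  rw [key]
  have hnn : ∀ i, 0 ≤ ∫ ω, |ξ i ω| ^ 3 ∂μ := fun i => integral_nonneg fun _ => by positivity
  have hnn2 : ∀ i, 0 ≤ ∫ ω, ξ i ω ^ 2 ∂μ := fun i => integral_nonneg fun _ => sq_nonneg _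
  calc _ ≤ ∑ i, |(∫ ω, ξ i ω ^ 2 ∂μ) * ∫ ω, steinDeriv z (S ω) ∂μ -
        ∫ ω, ξ i ω * steinSol z (S ω) ∂μ| := Finset.abs_sum_le_sum_abs _ _
    _ ≤ ∑ i, (28 * ∫ ω, |ξ i ω| ^ 3 ∂μ + 40 * d * ∫ ω, ξ i ω ^ 2 ∂μ) := by
        refine Finset.sum_le_sum fun i _ => ?_
        have hsum := Finset.add_sum_erase Finset.univ (fun i => ∫ ω, ξ i ω ^ 2 ∂μ)
          (Finset.mem_univ i)
        have hsum3 := Finset.add_sum_erase Finset.univ (fun i => ∫ ω, |ξ i ω| ^ 3 ∂μ)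
          (Finset.mem_univ i)
        have hv1 : ∑ j ∈ Finset.univ.erase i, ∫ ω, ξ j ω ^ 2 ∂μ ≤ 1 := by linarith [hnn2 i]
        have hXm : Measurable fun ω => ∑ j ∈ Finset.univ.erase i, ξ j ω :=
          Finset.measurable_fun_sum _ fun i _ => hm i
        have := stein_term (z := z) (d := d) hXm (hm i) (indepFun_sum_erase hm hind _ i)
          (integrable_finsetSum _ fun i _ => hξi i) (integral_abs_sum_le_one hind h3 h0 hv1)
          (h3 i) (h0 i) (fun t ht => by
            -- Deleting one summand of variance at most `1/2` leaves total variance at least `1/2`,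
            -- as concentration requires; the interval has length `2 t`, hence the coefficient `4`.
            have hc := concentration hm hind h3 h0 hd (s := Finset.univ.erase i)
              (by linarith [hnn i]) (by linarith [hi i]) hv1 (a := z - t) (b := z + t)
              (by linarith)
            have e : {ω | |∑ j ∈ Finset.univ.erase i, ξ j ω - z| ≤ t} =
              {ω | z - t ≤ ∑ j ∈ Finset.univ.erase i, ξ j ω ∧
                ∑ j ∈ Finset.univ.erase i, ξ j ω ≤ z + t} := by
              ext ω
              simp only [Set.mem_ofPred_eq, abs_le]
              constructor <;> rintro ⟨h1, h2⟩ <;> constructor <;> linarith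
            rw [e]
            linarith)
        simp only [sum_erase_eq_sub (Finset.mem_univ i), sub_add_cancel] at this
        exact this
    _ = 28 * (∑ i, ∫ ω, |ξ i ω| ^ 3 ∂μ) + 40 * d := by
        rw [Finset.sum_add_distrib, ← Finset.mul_sum, ← Finset.mul_sum, hv, mul_one]
    _ ≤ 68 * d := by linarith

end BerryEsseen

/-! ### From distribution functions to integrals of exponentials over half lines -/

section HalfLine

variable {ν ρ : Measure ℝ} [IsProbabilityMeasure ν] [IsProbabilityMeasure ρ] {D : ℝ}

theorem abs_measureReal_Iio_sub_le (h : ∀ z, |ν.real (Set.Iic z) - ρ.real (Set.Iic z)| ≤ D) (z : ℝ) :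
    |ν.real (Set.Iio z) - ρ.real (Set.Iio z)| ≤ D := by
  obtain ⟨u, hu1, hu2, hu3⟩ := exists_seq_strictMono_tendsto z
  have hU : ⋃ n, Set.Iic (u n) = Set.Iio z := by
    ext x
    simp only [Set.mem_iUnion, Set.mem_Iic, Set.mem_Iio]
    refine ⟨fun ⟨n, hn⟩ => hn.trans_lt (hu2 n), fun hx => ?_⟩
    obtain ⟨n, hn⟩ := (hu3.eventually (lt_mem_nhds hx)).exists
    exact ⟨n, hn.le⟩
  have hmono : Monotone fun n => Set.Iic (u n) := fun a b hab =>
    Set.Iic_subset_Iic.2 (hu1.monotone hab)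
  have ht : ∀ κ : Measure ℝ, IsProbabilityMeasure κ →
      Tendsto (fun n => κ.real (Set.Iic (u n))) atTop (𝓝 (κ.real (Set.Iio z))) := by
    intro κ _
    have := tendsto_measure_iUnion_atTop (μ := κ) hmono
    rw [hU] at this
    exact (ENNReal.tendsto_toReal (measure_ne_top _ _)).comp this
  exact le_of_tendsto ((ht ν inferInstance).sub (ht ρ inferInstance)).abs
    (Eventually.of_forall fun n => h (u n))

/-- A lower set of the line is empty, everything, or a closed or open left half line; the open case
is a limit of closed ones. Allowing all lower sets covers every level set that occurs below,
including the degenerate ones. -/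
theorem abs_measureReal_lowerSet_sub_le
    (h : ∀ z, |ν.real (Set.Iic z) - ρ.real (Set.Iic z)| ≤ D) {L : Set ℝ} (hL : IsLowerSet L) :
    |ν.real L - ρ.real L| ≤ D := by
  have hD : 0 ≤ D := (abs_nonneg _).trans (h 0)
  rcases L.eq_empty_or_nonempty with rfl | hne
  · simpa using hD
  by_cases hb : BddAbove L
  · by_cases hc : sSup L ∈ L
    · have : L = Set.Iic (sSup L) := by
        ext x
        exact ⟨fun hx => le_csSup hb hx, fun hx => hL hx hc⟩
      rw [this]; exact h _
    · have : L = Set.Iio (sSup L) := by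
        ext x
        refine ⟨fun hx => lt_of_le_of_ne (le_csSup hb hx) fun e => hc (e ▸ hx), fun hx => ?_⟩
        obtain ⟨y, hy, hxy⟩ := exists_lt_of_lt_csSup hne hx
        exact hL hxy.le hy
      rw [this]; exact abs_measureReal_Iio_sub_le h _
  · have : L = Set.univ := by
      rw [Set.eq_univ_iff_forall]
      intro x
      rw [not_bddAbove_iff] at hb
      obtain ⟨y, hy, hxy⟩ := hb x
      exact hL hxy.le hy
    rw [this]; simpa using hD

theorem isLowerSet_measurableSet {L : Set ℝ} (hL : IsLowerSet L) : MeasurableSet L :=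
  hL.ordConnected.measurableSet

theorem abs_measureReal_diff_sub_le
    (h : ∀ z, |ν.real (Set.Iic z) - ρ.real (Set.Iic z)| ≤ D) {L T : Set ℝ} (hL : IsLowerSet L)
    (hT : IsLowerSet T) : |ν.real (T \ L) - ρ.real (T \ L)| ≤ 2 * D := by
  have hD : 0 ≤ D := (abs_nonneg _).trans (h 0)
  rcases hL.total hT with hs | hs
  · rw [measureReal_sdiff hs (isLowerSet_measurableSet hL),
      measureReal_sdiff hs (isLowerSet_measurableSet hL)]
    have h1 := abs_le.1 (abs_measureReal_lowerSet_sub_le h hL)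
    have h2 := abs_le.1 (abs_measureReal_lowerSet_sub_le h hT)
    rw [abs_le]; constructor <;> linarith
  · rw [Set.sdiff_eq_empty.2 hs]; simpa using hD

/-- Layer-cake formula: the integrand takes values in `[0, 1]`, and each superlevel set with `t > 0`
is a difference of two lower sets, on which the measures differ by at most `2 D`. For `l = 0` the
exponential level set is empty or all of `ℝ`. -/
theorem abs_integral_indicator_exp_sub_le
    (h : ∀ z, |ν.real (Set.Iic z) - ρ.real (Set.Iic z)| ≤ D) {L : Set ℝ} (hL : IsLowerSet L)
    (h0 : Set.Iio 0 ⊆ L) {l : ℝ} (hl : 0 ≤ l) :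
    |∫ z, Lᶜ.indicator (fun z => Real.exp (-l * z)) z ∂ν -
      ∫ z, Lᶜ.indicator (fun z => Real.exp (-l * z)) z ∂ρ| ≤ 2 * D := by
  set f : ℝ → ℝ := Lᶜ.indicator fun z => Real.exp (-l * z) with hf
  have hLm := isLowerSet_measurableSet hL
  have hfm : Measurable f := (by fun_prop : Measurable fun z => Real.exp (-l * z)).indicator hLm.compl
  have hf0 : ∀ z, 0 ≤ f z := fun z => Set.indicator_nonneg (fun _ _ => (Real.exp_pos _).le) z
  have hf1 : ∀ z, f z ≤ 1 := fun z => by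
    by_cases hz : z ∈ Lᶜ
    · rw [hf, Set.indicator_of_mem hz, Real.exp_le_one_iff]
      have : 0 ≤ z := not_lt.1 fun hlt => hz (h0 hlt)
      nlinarith
    · rw [hf, Set.indicator_of_notMem hz]; exact zero_le_one
  have hfi : ∀ κ : Measure ℝ, IsProbabilityMeasure κ → Integrable f κ := fun κ _ =>
    (integrable_const (1 : ℝ)).mono' hfm.aestronglyMeasurable
      (ae_of_all _ fun z => by rw [Real.norm_of_nonneg (hf0 z)]; exact hf1 z)
  have hlc : ∀ κ : Measure ℝ, IsProbabilityMeasure κ →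
      ∫ z, f z ∂κ = ∫ t in Set.Ioc 0 1, κ.real {z | t ≤ f z} := fun κ hκ =>
    (hfi κ hκ).integral_eq_integral_Ioc_meas_le (ae_of_all _ hf0) (ae_of_all _ hf1)
  have hint : ∀ κ : Measure ℝ, IsProbabilityMeasure κ →
      IntegrableOn (fun t => κ.real {z | t ≤ f z}) (Set.Ioc 0 1) := by
    intro κ _
    have hanti : Antitone fun t => κ.real {z | t ≤ f z} := fun s t hst =>
      measureReal_mono fun z hz => hst.trans hz
    exact ((hanti.antitoneOn _).integrableOn_isCompact isCompact_Icc).mono_set Set.Ioc_subset_Icc_self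
  rw [hlc ν inferInstance, hlc ρ inferInstance,
    ← integral_sub (hint ν inferInstance) (hint ρ inferInstance)]
  have hbound : ∀ t ∈ Set.Ioc (0 : ℝ) 1,
      ‖ν.real {z | t ≤ f z} - ρ.real {z | t ≤ f z}‖ ≤ 2 * D := by
    intro t ht
    have e : {z | t ≤ f z} = {z | t ≤ Real.exp (-l * z)} \ L := by
      ext z
      rw [Set.mem_ofPred_eq, Set.mem_sdiff, Set.mem_ofPred_eq, hf]
      by_cases hz : z ∈ L
      · rw [Set.indicator_of_notMem (not_not.2 hz)]
        simp [hz, ht.1]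
      · rw [Set.indicator_of_mem hz]
        simp [hz]
    rw [e]
    refine abs_measureReal_diff_sub_le h hL fun x y hxy hx => ?_
    refine le_trans hx (Real.exp_le_exp.2 ?_)
    nlinarith
  have := norm_setIntegral_le_of_norm_le_const (μ := volume) (by simp) hbound
  simpa using this

/-- Both half lines are needed: a negative saddlepoint is handled through the complementary event,
where the inequality is strict. The Gaussian side does not see the endpoint. -/
theorem abs_integral_exp_half_line_sub_le
    (h : ∀ z, |ν.real (Set.Iic z) - cdf (gaussianReal 0 1) z| ≤ D) {l : ℝ} (hl : 0 ≤ l) :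
    |∫ z, (Set.Ici (0 : ℝ)).indicator (fun z => Real.exp (-l * z)) z ∂ν -
      gaussianPDFReal 0 1 0 * mills l| ≤ 2 * D ∧
    |∫ z, (Set.Ioi (0 : ℝ)).indicator (fun z => Real.exp (-l * z)) z ∂ν -
      gaussianPDFReal 0 1 0 * mills l| ≤ 2 * D := by
  simp_rw [cdf_eq_real] at h
  rw [← integral_exp_indicator_gaussianReal]
  constructor
  · have h1 := abs_integral_indicator_exp_sub_le h (isLowerSet_Iio (0 : ℝ)) subset_rfl hl
    rw [Set.compl_Iio] at h1
    have : NullSingletonClass (gaussianReal 0 1) := nullSingletonClass_gaussianReal one_ne_zero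
    rwa [integral_congr_ae (μ := gaussianReal 0 1) (indicator_ae_eq_of_ae_eq_set
      (f := fun z => Real.exp (-l * z)) (Ioi_ae_eq_Ici (a := (0 : ℝ)) (μ := gaussianReal 0 1)))]
  · have h1 := abs_integral_indicator_exp_sub_le h (isLowerSet_Iic (0 : ℝ))
      Set.Iio_subset_Iic_self hl
    rwa [Set.compl_Iic] at h1

end HalfLine

/-! ### Exponential tilting of independent variables -/

section Tilting

variable {Ω ι : Type*} [MeasurableSpace Ω] {μ : Measure Ω} [IsProbabilityMeasure μ] [Fintype ι]
  {W : ι → Ω → ℝ} {s : ℝ}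

theorem integrable_exp_sum (hm : ∀ i, Measurable (W i)) (hind : iIndepFun W μ)
    (hint : ∀ i, Integrable (fun ω => Real.exp (s * W i ω)) μ) :
    Integrable (fun ω => Real.exp (s * ∑ i, W i ω)) μ := by
  have := hind.integrable_exp_mul_sum hm (s := Finset.univ) (t := s) fun i _ => hint i
  simpa using this

omit [IsProbabilityMeasure μ] in
theorem integral_exp_sum (hm : ∀ i, Measurable (W i)) (hind : iIndepFun W μ) :
    ∫ ω, Real.exp (s * ∑ i, W i ω) ∂μ = ∏ i, mgf (W i) μ s := by
  have := hind.mgf_sum hm Finset.univ (t := s)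
  rw [← this, mgf]
  simp

omit [IsProbabilityMeasure μ] in
-- The density `exp (s ∑ W_i) / ∏ mgf` is a product of functions of the separate variables, so
-- independence factorises the mass of a box.
theorem tilted_sum_iInter (hm : ∀ i, Measurable (W i)) (hind : iIndepFun W μ)
    {A : ι → Set ℝ} (hA : ∀ i, MeasurableSet (A i)) :
    μ.tilted (fun ω => s * ∑ i, W i ω) (⋂ i, W i ⁻¹' A i) =
      ∏ i, μ.tilted (fun ω => s * W i ω) (W i ⁻¹' A i) := by
  have hAm : MeasurableSet (⋂ i, W i ⁻¹' A i) := MeasurableSet.iInter fun i => hm i (hA i)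
  rw [tilted_apply_eq_ofReal_integral' _ hAm]
  simp_rw [tilted_apply_eq_ofReal_integral' _ (hm _ (hA _))]
  rw [← ENNReal.ofReal_prod_of_nonneg fun i _ => integral_nonneg fun ω => by positivity]
  congr 1
  rw [integral_exp_sum hm hind, ← integral_indicator hAm]
  set φ : ι → ℝ → ℝ := fun i => (A i).indicator fun x => Real.exp (s * x) / mgf (W i) μ s with hφ
  have hφm : ∀ i, Measurable (φ i) := fun i =>
    ((by fun_prop : Measurable fun x => Real.exp (s * x)).div_const _).indicator (hA i)
  have e1 : ∀ ω, (⋂ i, W i ⁻¹' A i).indicator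
      (fun ω => Real.exp (s * ∑ i, W i ω) / ∏ i, mgf (W i) μ s) ω = ∏ i, φ i (W i ω) := by
    intro ω
    by_cases hω : ω ∈ ⋂ i, W i ⁻¹' A i
    · rw [Set.indicator_of_mem hω, Finset.mul_sum, Real.exp_sum, ← Finset.prod_div_distrib]
      refine Finset.prod_congr rfl fun i _ => ?_
      rw [hφ]
      have hi : W i ω ∈ A i := Set.mem_iInter.1 hω i
      simp only [Set.indicator_of_mem hi]
    · rw [Set.indicator_of_notMem hω]
      have hω' : ∃ i, W i ω ∉ A i := by simpa using hω
      obtain ⟨i, hi⟩ := hω'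
      refine Eq.symm (Finset.prod_eq_zero (Finset.mem_univ i) ?_)
      simp [hφ, hi]
  simp_rw [e1]
  rw [hind.integral_fun_prod_comp (fun i => (hm i).aemeasurable)
    fun i => (hφm i).aestronglyMeasurable]
  refine Finset.prod_congr rfl fun i _ => ?_
  rw [← integral_indicator (hm i (hA i))]
  rfl

theorem isProbabilityMeasure_tilted_sum (hm : ∀ i, Measurable (W i)) (hind : iIndepFun W μ)
    (hint : ∀ i, Integrable (fun ω => Real.exp (s * W i ω)) μ) :
    IsProbabilityMeasure (μ.tilted fun ω => s * ∑ i, W i ω) :=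
  isProbabilityMeasure_tilted (integrable_exp_sum hm hind hint)

/-- Boxes constrained in a single coordinate: every other factor is the total mass of a tilted
probability measure. Tilting by the sum thus acts on each marginal as its own tilt. -/
theorem map_tilted_sum (hm : ∀ i, Measurable (W i)) (hind : iIndepFun W μ)
    (hint : ∀ i, Integrable (fun ω => Real.exp (s * W i ω)) μ) (i : ι) :
    (μ.tilted fun ω => s * ∑ i, W i ω).map (W i) = (μ.tilted fun ω => s * W i ω).map (W i) := by
  classical
  ext B hB
  rw [Measure.map_apply (hm i) hB, Measure.map_apply (hm i) hB]
  have h := tilted_sum_iInter (s := s) hm hind (A := fun j => if j = i then B else Set.univ)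
    fun j => by split_ifs; exacts [hB, MeasurableSet.univ]
  have e : (⋂ j, W j ⁻¹' (if j = i then B else Set.univ)) = W i ⁻¹' B := by
    ext ω
    simp only [Set.mem_iInter, Set.mem_preimage]
    refine ⟨fun h => by simpa using h i, fun h j => ?_⟩
    split_ifs with hj
    · subst hj; exact h
    · trivial
  rw [e] at h
  rw [h, ← Finset.mul_prod_erase _ _ (Finset.mem_univ i)]
  have : ∀ j ∈ Finset.univ.erase i,
      (μ.tilted fun ω => s * W j ω) (W j ⁻¹' (if j = i then B else Set.univ)) = 1 := by
    intro j hj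
    have := isProbabilityMeasure_tilted (hint j)
    rw [if_neg (Finset.ne_of_mem_erase hj), Set.preimage_univ, measure_univ]
  rw [Finset.prod_congr rfl this]
  simp

/-- The factorisation over boxes, with the whole line in the unconstrained coordinates. -/
theorem iIndepFun_tilted_sum (hm : ∀ i, Measurable (W i)) (hind : iIndepFun W μ)
    (hint : ∀ i, Integrable (fun ω => Real.exp (s * W i ω)) μ) :
    iIndepFun W (μ.tilted fun ω => s * ∑ i, W i ω) := by
  classical
  have := isProbabilityMeasure_tilted_sum hm hind hint
  rw [iIndepFun_iff_measure_inter_preimage_eq_mul]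
  intro S sets hsets
  set A : ι → Set ℝ := fun j => if j ∈ S then sets j else Set.univ with hAdef
  have hA : ∀ j, MeasurableSet (A j) := fun j => by
    simp only [hAdef]
    split_ifs with hj
    exacts [hsets j hj, MeasurableSet.univ]
  have h := tilted_sum_iInter (s := s) hm hind hA
  have e : (⋂ j, W j ⁻¹' A j) = ⋂ j ∈ S, W j ⁻¹' sets j := by
    ext ω
    simp only [Set.mem_iInter, Set.mem_preimage, hAdef]
    refine ⟨fun h j hj => by simpa [hj] using h j, fun h j => ?_⟩
    split_ifs with hj
    · exact h j hj
    · trivial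
  rw [e] at h
  rw [h, ← Finset.prod_subset (Finset.subset_univ S)]
  · refine Finset.prod_congr rfl fun j hj => ?_
    have hB : MeasurableSet (sets j) := hsets j hj
    have := congrArg (fun κ => κ (sets j)) (map_tilted_sum hm hind hint j)
    simp only [Measure.map_apply (hm j) hB] at this
    simp only [hAdef, if_pos hj]
    exact this.symm
  · intro j _ hj
    have := isProbabilityMeasure_tilted (hint j)
    simp [hAdef, hj]

theorem integral_comp_tilted_sum (hm : ∀ i, Measurable (W i)) (hind : iIndepFun W μ)
    (hint : ∀ i, Integrable (fun ω => Real.exp (s * W i ω)) μ) (i : ι) {φ : ℝ → ℝ}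
    (hφ : Measurable φ) :
    ∫ ω, φ (W i ω) ∂(μ.tilted fun ω => s * ∑ i, W i ω) =
      ∫ ω, φ (W i ω) ∂(μ.tilted fun ω => s * W i ω) := by
  rw [← integral_map (hm i).aemeasurable hφ.aestronglyMeasurable, map_tilted_sum hm hind hint i,
    integral_map (hm i).aemeasurable hφ.aestronglyMeasurable]

theorem memLp_tilted_sum (hm : ∀ i, Measurable (W i)) (hind : iIndepFun W μ)
    (hint : ∀ i, Integrable (fun ω => Real.exp (s * W i ω)) μ) (i : ι) {p : ENNReal}
    (h : MemLp (W i) p (μ.tilted fun ω => s * W i ω)) :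
    MemLp (W i) p (μ.tilted fun ω => s * ∑ i, W i ω) := by
  have h1 : MemLp id p ((μ.tilted fun ω => s * W i ω).map (W i)) := by
    rw [memLp_map_measure_iff measurable_id.aestronglyMeasurable (hm i).aemeasurable]
    exact h
  rw [← map_tilted_sum hm hind hint i,
    memLp_map_measure_iff measurable_id.aestronglyMeasurable (hm i).aemeasurable] at h1
  exact h1

end Tilting

/-! ### Tail probabilities of the sum through the tilted law -/

section Tail

variable {Ω ι : Type*} [MeasurableSpace Ω] {μ : Measure Ω} [IsProbabilityMeasure μ] [Fintype ι]
  {W : ι → Ω → ℝ} {s : ℝ}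

/-- Under the tilted law the normalised sum is close to normal. -/
theorem tilted_sum_berry_esseen (hm : ∀ i, Measurable (W i)) (hind : iIndepFun W μ)
    (hs : ∀ i, s ∈ interior (integrableExpSet (W i) μ)) {B V : ℝ} (hB : 0 < B)
    (h3 : ∀ i, ∫ ω, |W i ω| ^ 3 ∂(μ.tilted fun ω => s * W i ω) ≤ B)
    (hV : V = ∑ i, iteratedDeriv 2 (cgf (W i) μ) s) (hV0 : 0 < V)
    (hVi : ∀ i, iteratedDeriv 2 (cgf (W i) μ) s ≤ V / 2) (z : ℝ) :
    |(μ.tilted fun ω => s * ∑ i, W i ω).real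
        {ω | (∑ i, W i ω - ∑ i, deriv (cgf (W i) μ) s) / √V ≤ z} - cdf (gaussianReal 0 1) z| ≤
      68 * (8 * B * Fintype.card ι / (V * √V)) := by
  have hint : ∀ i, Integrable (fun ω => Real.exp (s * W i ω)) μ := fun i =>
    interior_subset (s := integrableExpSet (W i) μ) (hs i)
  set ρ := μ.tilted fun ω => s * ∑ i, W i ω with hρ
  have hρp : IsProbabilityMeasure ρ := isProbabilityMeasure_tilted_sum hm hind hint
  have hτp : ∀ i, IsProbabilityMeasure (μ.tilted fun ω => s * W i ω) := fun i =>
    isProbabilityMeasure_tilted (hint i)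
  set m : ι → ℝ := fun i => deriv (cgf (W i) μ) s with hmdef
  have hτ3 : ∀ i, MemLp (W i) 3 (μ.tilted fun ω => s * W i ω) := fun i =>
    memLp_tilted_mul (hs i) 3
  have hρ3 : ∀ i, MemLp (W i) 3 ρ := fun i => memLp_tilted_sum hm hind hint i (hτ3 i)
  have hmean : ∀ i, ∫ ω, W i ω ∂ρ = m i := fun i =>
    (integral_comp_tilted_sum hm hind hint i measurable_id).trans (integral_tilted_mul_self (hs i))
  have hvar : ∀ i, ∫ ω, (W i ω - m i) ^ 2 ∂ρ = iteratedDeriv 2 (cgf (W i) μ) s := by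
    intro i
    rw [← variance_tilted_mul (hs i), variance_eq_integral (hm i).aemeasurable,
      integral_tilted_mul_self (hs i)]
    exact integral_comp_tilted_sum hm hind hint i (φ := fun x => (x - m i) ^ 2) (by fun_prop)
  have hthird : ∀ i, ∫ ω, |W i ω - m i| ^ 3 ∂ρ ≤ 8 * B := by
    intro i
    have e := integral_comp_tilted_sum hm hind hint i (φ := fun x => |x| ^ 3) (by fun_prop)
    have h := integral_abs_sub_pow_three_le (hρ3 i)
    rw [hmean i] at h
    have h4 := h3 i
    rw [← e] at h4
    exact h.trans (by linarith)
  have hσ : 0 < √V := Real.sqrt_pos.2 hV0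
  have hσ2 : √V ^ 2 = V := Real.sq_sqrt hV0.le
  set ξ : ι → Ω → ℝ := fun i ω => (W i ω - m i) / √V with hξ
  have hne : Nonempty ι := by
    by_contra hcon
    rw [not_nonempty_iff] at hcon
    simp at hV
    linarith
  have hcard : (0 : ℝ) < Fintype.card ι := by exact_mod_cast Fintype.card_pos
  have hξ2 : ∀ i, ∫ ω, ξ i ω ^ 2 ∂ρ = iteratedDeriv 2 (cgf (W i) μ) s / V := by
    intro i
    rw [← hvar i, ← integral_div]
    simp only [hξ, div_pow, hσ2]
  -- Each centred third absolute moment is at most `8 B`; dividing by `(√V)³ = V √V` and summing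
  -- gives this `d`.
  have hBE := berry_esseen (ξ := ξ) (μ := ρ) (d := 8 * B * Fintype.card ι / (V * √V))
    (fun i => ((hm i).sub_const _).div_const _)
    ((iIndepFun_tilted_sum hm hind hint).comp (fun i x => (x - m i) / √V) fun i => by fun_prop)
    (fun i => by
      have : MemLp (fun ω => (√V)⁻¹ * (W i ω - m i)) 3 ρ :=
        ((hρ3 i).sub (memLp_const _)).const_mul _
      refine this.congr_norm ?_ ?_
      · exact (((hm i).sub_const _).div_const _).aestronglyMeasurable
      · exact ae_of_all _ fun ω => by simp only [hξ, div_eq_inv_mul])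
    (fun i => by
      simp only [hξ]
      rw [integral_div, integral_sub (integrable_of_memLp_three (hρ3 i)) (integrable_const _),
        hmean i]
      simp)
    (by positivity)
    (by
      have : ∀ i ∈ Finset.univ, ∫ ω, |ξ i ω| ^ 3 ∂ρ ≤ 8 * B / (V * √V) := fun i _ => by
        simp only [hξ, abs_div, div_pow, abs_of_pos hσ]
        rw [integral_div]
        have e : √V ^ 3 = V * √V := by rw [pow_succ, hσ2]
        rw [e]
        gcongr
        exact hthird i
      refine (Finset.sum_le_card_nsmul _ _ _ this).trans (le_of_eq ?_)
      rw [nsmul_eq_mul, Finset.card_univ]; ring)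
    (by simp only [hξ2]; rw [← Finset.sum_div, ← hV, div_self hV0.ne'])
    (fun i => by rw [hξ2, div_le_iff₀ hV0]; linarith [hVi i]) z
  have e : ∀ ω, (∑ i, W i ω - ∑ i, m i) / √V = ∑ i, ξ i ω := fun ω => by
    simp only [hξ]
    rw [← Finset.sum_div, Finset.sum_sub_distrib]
  simp only [e]
  exact hBE

/-- With `Z = (S - x) / σ`, the weight `exp (-s σ Z) = exp (-s S + s x)` cancels the tilting density
up to a constant, so the expectation becomes an untilted probability. -/
theorem integral_tilted_sum_exp_indicator (hm : ∀ i, Measurable (W i)) (hind : iIndepFun W μ)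
    (hint : ∀ i, Integrable (fun ω => Real.exp (s * W i ω)) μ) {σ : ℝ} (hσ : 0 < σ) (x : ℝ)
    {H : Set ℝ} (hH : MeasurableSet H) :
    ∫ z, H.indicator (fun z => Real.exp (-(s * σ) * z)) z
      ∂((μ.tilted fun ω => s * ∑ i, W i ω).map fun ω => (∑ i, W i ω - x) / σ) =
    Real.exp (s * x - ∑ i, cgf (W i) μ s) * μ.real {ω | (∑ i, W i ω - x) / σ ∈ H} := by
  have hSm : Measurable fun ω => ∑ i, W i ω := Finset.measurable_fun_sum _ fun i _ => hm i
  have hZm : Measurable fun ω => (∑ i, W i ω - x) / σ := (hSm.sub_const _).div_const _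
  have hset : MeasurableSet {ω | (∑ i, W i ω - x) / σ ∈ H} := hZm hH
  rw [integral_map hZm.aemeasurable (((by fun_prop : Measurable fun z =>
    Real.exp (-(s * σ) * z)).indicator hH).aestronglyMeasurable), integral_tilted,
    integral_exp_sum hm hind]
  have hprod : ∏ i, mgf (W i) μ s = Real.exp (∑ i, cgf (W i) μ s) := by
    rw [Real.exp_sum]
    exact Finset.prod_congr rfl fun i _ => (exp_cgf (hint i)).symm
  have e : ∀ ω, (Real.exp (s * ∑ i, W i ω) / ∏ i, mgf (W i) μ s) •
      H.indicator (fun z => Real.exp (-(s * σ) * z)) ((∑ i, W i ω - x) / σ) =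
      {ω | (∑ i, W i ω - x) / σ ∈ H}.indicator
        (fun _ => Real.exp (s * x - ∑ i, cgf (W i) μ s)) ω := by
    intro ω
    by_cases hω : (∑ i, W i ω - x) / σ ∈ H
    · rw [Set.indicator_of_mem hω, Set.indicator_of_mem (s := {ω | (∑ i, W i ω - x) / σ ∈ H}) hω, hprod,
        ← Real.exp_sub, smul_eq_mul, ← Real.exp_add]
      congr 1
      field_simp
      ring
    · rw [Set.indicator_of_notMem hω, smul_zero,
        Set.indicator_of_notMem (s := {ω | (∑ i, W i ω - x) / σ ∈ H}) hω]
  simp_rw [e]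
  rw [integral_indicator hset, setIntegral_const, smul_eq_mul, mul_comm]

/-- The tail after undoing the tilt, compared with its Gaussian value. The choice of `x` as the
tilted mean is what centres the normal approximation. The constant is `2 * 68 * 8`. -/
theorem tail_sum_estimate (hm : ∀ i, Measurable (W i)) (hind : iIndepFun W μ) (hs0 : 0 ≤ s)
    (hs : ∀ i, s ∈ interior (integrableExpSet (W i) μ)) {B V x : ℝ} (hB : 0 < B)
    (h3 : ∀ i, ∫ ω, |W i ω| ^ 3 ∂(μ.tilted fun ω => s * W i ω) ≤ B)
    (hV : V = ∑ i, iteratedDeriv 2 (cgf (W i) μ) s) (hV0 : 0 < V)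
    (hVi : ∀ i, iteratedDeriv 2 (cgf (W i) μ) s ≤ V / 2) (hx : x = ∑ i, deriv (cgf (W i) μ) s) :
    |Real.exp (s * x - ∑ i, cgf (W i) μ s) * μ.real {ω | x ≤ ∑ i, W i ω} -
        gaussianPDFReal 0 1 0 * mills (s * √V)| ≤ 1088 * B * Fintype.card ι / (V * √V) ∧
    |Real.exp (s * x - ∑ i, cgf (W i) μ s) * μ.real {ω | x < ∑ i, W i ω} -
        gaussianPDFReal 0 1 0 * mills (s * √V)| ≤ 1088 * B * Fintype.card ι / (V * √V) := by
  have hint : ∀ i, Integrable (fun ω => Real.exp (s * W i ω)) μ := fun i =>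
    interior_subset (s := integrableExpSet (W i) μ) (hs i)
  have hρp := isProbabilityMeasure_tilted_sum hm hind hint
  have hσ : 0 < √V := Real.sqrt_pos.2 hV0
  have hSm : Measurable fun ω => ∑ i, W i ω := Finset.measurable_fun_sum _ fun i _ => hm i
  have hZm : Measurable fun ω => (∑ i, W i ω - x) / √V := (hSm.sub_const _).div_const _
  have hνp := Measure.isProbabilityMeasure_map (μ := μ.tilted fun ω => s * ∑ i, W i ω)
    hZm.aemeasurable
  have hBE : ∀ z, |((μ.tilted fun ω => s * ∑ i, W i ω).map
      fun ω => (∑ i, W i ω - x) / √V).real (Set.Iic z) - cdf (gaussianReal 0 1) z| ≤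
      68 * (8 * B * Fintype.card ι / (V * √V)) := fun z => by
    rw [map_measureReal_apply hZm measurableSet_Iic, hx]
    exact tilted_sum_berry_esseen hm hind hs hB h3 hV hV0 hVi z
  have hconst : 2 * (68 * (8 * B * Fintype.card ι / (V * √V))) =
    1088 * B * Fintype.card ι / (V * √V) := by ring
  obtain ⟨h1, h2⟩ := abs_integral_exp_half_line_sub_le hBE (mul_nonneg hs0 hσ.le)
  rw [hconst, integral_tilted_sum_exp_indicator hm hind hint hσ x measurableSet_Ici] at h1
  rw [hconst, integral_tilted_sum_exp_indicator hm hind hint hσ x measurableSet_Ioi] at h2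
  have e1 : {ω | (∑ i, W i ω - x) / √V ∈ Set.Ici 0} = {ω | x ≤ ∑ i, W i ω} := by
    ext ω
    simp only [Set.mem_ofPred_eq, Set.mem_Ici]
    rw [le_div_iff₀ hσ, zero_mul, sub_nonneg]
  have e2 : {ω | (∑ i, W i ω - x) / √V ∈ Set.Ioi 0} = {ω | x < ∑ i, W i ω} := by
    ext ω
    simp only [Set.mem_ofPred_eq, Set.mem_Ioi]
    rw [lt_div_iff₀ hσ, zero_mul, sub_pos]
  rw [e1] at h1
  rw [e2] at h2
  exact ⟨h1, h2⟩

end Tail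

/-! ### Cumulant generating functions under an exponential tail bound -/

section SubExponential

variable {Ω : Type*} [MeasurableSpace Ω] {μ : Measure Ω} {X : Ω → ℝ} {θ β s : ℝ}

/-- `X` is centred with tails bounded by `θ * exp (-β t)`. -/
structure SubExponential (X : Ω → ℝ) (μ : Measure Ω) (θ β : ℝ) : Prop where
  measurable : Measurable X
  mean : ∫ ω, X ω ∂μ = 0
  tail : ∀ t : ℝ, 0 < t → μ.real {ω | t ≤ |X ω|} ≤ θ * Real.exp (-β * t)

/-- A bound for the exponentially weighted absolute moments of order at most three. -/
noncomputable def momentBound (θ β : ℝ) : ℝ := 6 * (1 + 4 / β) ^ 3 * (1 + θ)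

theorem one_le_momentBound (hθ : 0 < θ) (hβ : 0 < β) : 1 ≤ momentBound θ β := by
  have h1 : 1 ≤ (1 + 4 / β) ^ 3 := one_le_pow₀ (by linarith [div_pos (by norm_num : (0 : ℝ) < 4) hβ])
  unfold momentBound
  nlinarith

theorem SubExponential.neg (h : SubExponential X μ θ β) : SubExponential (-X) μ θ β where
  measurable := h.measurable.neg
  mean := by simp [integral_neg, h.mean]
  tail t ht := by simpa using h.tail t ht

variable [IsProbabilityMeasure μ]

/-- Layer-cake formula for `exp (b |X|) - 1`; the tail bound leaves the integral of `θ b exp (-(β -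
b) t)`. -/
theorem SubExponential.lintegral_exp_abs_le (h : SubExponential X μ θ β) {b : ℝ} (hb : 0 < b)
    (hbβ : b < β) (hθ : 0 < θ) :
    ∫⁻ ω, ENNReal.ofReal (Real.exp (b * |X ω|) - 1) ∂μ ≤ ENNReal.ofReal (θ * b / (β - b)) := by
  have hlc := lintegral_comp_eq_lintegral_meas_le_mul μ (f := fun ω => |X ω|)
    (g := fun t => b * Real.exp (b * t)) (ae_of_all _ fun ω => abs_nonneg _)
    h.measurable.abs.aemeasurable
    (fun t _ => (by fun_prop : Continuous fun t => b * Real.exp (b * t)).intervalIntegrable _ _)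
    (ae_of_all _ fun t => by positivity)
  have hG : ∀ x : ℝ, ∫ t in (0 : ℝ)..x, b * Real.exp (b * t) = Real.exp (b * x) - 1 := by
    intro x
    rw [intervalIntegral.integral_eq_sub_of_hasDerivAt (f := fun t => Real.exp (b * t))]
    · simp
    · intro t _
      have := ((hasDerivAt_id t).const_mul b).exp
      simpa [mul_comm] using this
    · exact (by fun_prop : Continuous fun t => b * Real.exp (b * t)).intervalIntegrable _ _
  simp_rw [hG] at hlc
  rw [hlc]
  have hint : IntegrableOn (fun t => θ * b * Real.exp (-(β - b) * t)) (Set.Ioi 0) :=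
    (integrableOn_exp_mul_Ioi (by linarith) 0).const_mul _
  calc ∫⁻ t in Set.Ioi 0, μ {ω | t ≤ |X ω|} * ENNReal.ofReal (b * Real.exp (b * t))
      ≤ ∫⁻ t in Set.Ioi 0, ENNReal.ofReal (θ * b * Real.exp (-(β - b) * t)) := by
        refine setLIntegral_mono' measurableSet_Ioi fun t ht => ?_
        rw [← ofReal_measureReal (measure_ne_top _ _), ← ENNReal.ofReal_mul measureReal_nonneg]
        refine ENNReal.ofReal_le_ofReal ?_
        calc _ ≤ θ * Real.exp (-β * t) * (b * Real.exp (b * t)) := by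
              gcongr; exact h.tail t ht
          _ = θ * b * (Real.exp (-β * t) * Real.exp (b * t)) := by ring
          _ = _ := by rw [← Real.exp_add]; congr 2; ring
    _ = ENNReal.ofReal (∫ t in Set.Ioi 0, θ * b * Real.exp (-(β - b) * t)) :=
        (ofReal_integral_eq_lintegral_ofReal hint (ae_of_all _ fun t => by positivity)).symm
    _ = _ := by
        rw [integral_const_mul, integral_exp_mul_Ioi (by linarith)]
        rw [mul_zero, Real.exp_zero, neg_div_neg_eq]
        congr 1
        ring

theorem SubExponential.integrable_exp_abs (h : SubExponential X μ θ β) {b : ℝ} (hb : 0 < b)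
    (hbβ : b < β) (hθ : 0 < θ) :
    Integrable (fun ω => Real.exp (b * |X ω|)) μ ∧
      ∫ ω, Real.exp (b * |X ω|) ∂μ ≤ 1 + θ * b / (β - b) := by
  have hX := h.measurable
  have hl := h.lintegral_exp_abs_le hb hbβ hθ
  have h0 : ∀ ω, 0 ≤ Real.exp (b * |X ω|) - 1 := fun ω =>
    sub_nonneg.2 (Real.one_le_exp (by positivity))
  have hm : AEStronglyMeasurable (fun ω => Real.exp (b * |X ω|) - 1) μ := by fun_prop
  have hi : Integrable (fun ω => Real.exp (b * |X ω|) - 1) μ := by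
    refine ⟨hm, ?_⟩
    rw [hasFiniteIntegral_iff_ofReal (ae_of_all _ h0)]
    exact hl.trans_lt ENNReal.ofReal_lt_top
  have hi' : Integrable (fun ω => Real.exp (b * |X ω|)) μ := by
    refine (hi.add (integrable_const 1)).congr (ae_of_all _ fun ω => ?_)
    simp
  refine ⟨hi', ?_⟩
  have h1 : ∫ ω, (Real.exp (b * |X ω|) - 1) ∂μ ≤ θ * b / (β - b) := by
    rw [integral_eq_lintegral_of_nonneg_ae (ae_of_all _ h0) hm]
    refine ENNReal.toReal_le_of_le_ofReal ?_ hl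
    have : 0 < β - b := by linarith
    positivity
  rw [integral_sub hi' (integrable_const _)] at h1
  simp at h1
  linarith

theorem SubExponential.integrable_exp (h : SubExponential X μ θ β) (hθ : 0 < θ)
    (hs : |s| < β) : Integrable (fun ω => Real.exp (s * X ω)) μ := by
  have hX := h.measurable
  obtain ⟨b, hb1, hb2⟩ := exists_between hs
  have hb0 : 0 < b := (abs_nonneg s).trans_lt hb1
  refine (h.integrable_exp_abs hb0 hb2 hθ).1.mono' (by fun_prop) (ae_of_all _ fun ω => ?_)
  rw [Real.norm_eq_abs, Real.abs_exp]
  refine Real.exp_le_exp.2 ((le_abs_self _).trans ?_)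
  rw [abs_mul]
  gcongr

theorem SubExponential.mem_interior (h : SubExponential X μ θ β) (hθ : 0 < θ)
    (hs : |s| < β) : s ∈ interior (integrableExpSet X μ) := by
  refine _root_.mem_interior.2 ⟨Set.Ioo (-β) β, fun t ht => ?_, isOpen_Ioo, abs_lt.1 hs⟩
  exact h.integrable_exp hθ (abs_lt.2 ht)

/-- One factor `exp (β |x| / 4)` absorbs the power, through the exponential series and `k! ≤ 6`;
another dominates `exp (s x)`. -/
theorem abs_pow_mul_exp_le (hβ : 0 < β) (hs : |s| ≤ β / 4) {k : ℕ} (hk : k ≤ 3) (x : ℝ) :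
    |x| ^ k * Real.exp (s * x) ≤ 6 * (1 + 4 / β) ^ 3 * Real.exp (β / 2 * |x|) := by
  have h1 := Real.pow_div_factorial_le_exp (x := β / 4 * |x|) (by positivity) k
  rw [mul_pow, div_le_iff₀ (by positivity)] at h1
  have hfac : (k.factorial : ℝ) ≤ 6 := by
    have : k.factorial ≤ Nat.factorial 3 := Nat.factorial_le hk
    exact_mod_cast this
  have h2 : |x| ^ k ≤ 6 * (1 + 4 / β) ^ 3 * Real.exp (β / 4 * |x|) := by
    calc |x| ^ k = (4 / β) ^ k * ((β / 4) ^ k * |x| ^ k) := by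
          rw [← mul_assoc, ← mul_pow, div_mul_div_comm, mul_comm 4 β, div_self (by positivity)]
          simp
      _ ≤ (1 + 4 / β) ^ 3 * (Real.exp (β / 4 * |x|) * 6) := by
          refine mul_le_mul ?_ ?_ (by positivity) (by positivity)
          · calc (4 / β) ^ k ≤ (1 + 4 / β) ^ k := by gcongr; linarith
              _ ≤ _ := pow_le_pow_right₀ (by linarith [div_pos (by norm_num : (0 : ℝ) < 4) hβ]) hk
          · exact h1.trans (by gcongr)
      _ = _ := by ring
  have h3 : Real.exp (s * x) ≤ Real.exp (β / 4 * |x|) := by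
    refine Real.exp_le_exp.2 ((le_abs_self _).trans ?_)
    rw [abs_mul]
    gcongr
  calc |x| ^ k * Real.exp (s * x)
      ≤ 6 * (1 + 4 / β) ^ 3 * Real.exp (β / 4 * |x|) * Real.exp (β / 4 * |x|) := by gcongr
    _ = 6 * (1 + 4 / β) ^ 3 * Real.exp (β / 2 * |x|) := by
        rw [mul_assoc, ← Real.exp_add]; congr 2; ring

theorem SubExponential.integral_abs_pow_mul_exp_le (h : SubExponential X μ θ β) (hθ : 0 < θ)
    (hβ : 0 < β) (hs : |s| ≤ β / 4) {k : ℕ} (hk : k ≤ 3) :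
    Integrable (fun ω => |X ω| ^ k * Real.exp (s * X ω)) μ ∧
      ∫ ω, |X ω| ^ k * Real.exp (s * X ω) ∂μ ≤ momentBound θ β := by
  have hX := h.measurable
  obtain ⟨i1, i2⟩ := h.integrable_exp_abs (b := β / 2) (by positivity) (by linarith) hθ
  have hi : Integrable (fun ω => |X ω| ^ k * Real.exp (s * X ω)) μ := by
    refine (i1.const_mul (6 * (1 + 4 / β) ^ 3)).mono' (by fun_prop) (ae_of_all _ fun ω => ?_)
    rw [Real.norm_of_nonneg (by positivity)]
    exact abs_pow_mul_exp_le hβ hs hk _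
  refine ⟨hi, ?_⟩
  calc _ ≤ ∫ ω, 6 * (1 + 4 / β) ^ 3 * Real.exp (β / 2 * |X ω|) ∂μ :=
        integral_mono hi (i1.const_mul _) fun ω => abs_pow_mul_exp_le hβ hs hk _
    _ ≤ _ := by
        rw [integral_const_mul]
        have : θ * (β / 2) / (β - β / 2) = θ := by field_simp; ring
        rw [this] at i2
        unfold momentBound
        gcongr

/-- From `exp y ≥ 1 + y` and mean zero. Hence normalising a tilted moment never increases it. -/
theorem SubExponential.one_le_mgf (h : SubExponential X μ θ β) (hθ : 0 < θ) (hs : |s| < β) :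
    1 ≤ mgf X μ s := by
  have hint : Integrable X μ :=
    integrable_of_mem_interior_integrableExpSet (h.mem_interior hθ (by
      rw [abs_zero]; exact (abs_nonneg s).trans_lt hs))
  have : ∫ ω, (s * X ω + 1) ∂μ ≤ mgf X μ s :=
    integral_mono ((hint.const_mul s).add (integrable_const 1)) (h.integrable_exp hθ hs)
      fun ω => Real.add_one_le_exp _
  rw [integral_add (hint.const_mul s) (integrable_const 1), integral_const_mul, h.mean] at this
  simpa using this

theorem SubExponential.integral_tilted_abs_pow_three_le (h : SubExponential X μ θ β) (hθ : 0 < θ)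
    (hβ : 0 < β) (hs : |s| ≤ β / 4) :
    ∫ ω, |X ω| ^ 3 ∂(μ.tilted fun ω => s * X ω) ≤ momentBound θ β := by
  have hM := h.one_le_mgf hθ (s := s) (by linarith)
  rw [integral_tilted_mul_eq_mgf]
  have : ∀ ω, (Real.exp (s * X ω) / mgf X μ s) • |X ω| ^ 3 =
      |X ω| ^ 3 * Real.exp (s * X ω) / mgf X μ s := fun ω => by rw [smul_eq_mul]; ring
  simp_rw [this]
  rw [integral_div]
  have hb := (h.integral_abs_pow_mul_exp_le hθ hβ hs le_rfl).2
  exact (div_le_self (integral_nonneg fun _ => by positivity) hM).trans hb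

/-- The `k`-th moment under the exponentially tilted law. -/
noncomputable def tiltedMoment (X : Ω → ℝ) (μ : Measure Ω) (k : ℕ) (s : ℝ) : ℝ :=
  (∫ ω, X ω ^ k * Real.exp (s * X ω) ∂μ) / mgf X μ s

theorem SubExponential.abs_tiltedMoment_le (h : SubExponential X μ θ β) (hθ : 0 < θ)
    (hβ : 0 < β) (hs : |s| ≤ β / 4) {k : ℕ} (hk : k ≤ 3) :
    |tiltedMoment X μ k s| ≤ momentBound θ β := by
  have hM := h.one_le_mgf hθ (s := s) (by linarith)
  obtain ⟨h1, h2⟩ := h.integral_abs_pow_mul_exp_le hθ hβ hs hk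
  unfold tiltedMoment
  rw [abs_div, abs_of_pos (by linarith : 0 < mgf X μ s)]
  refine (div_le_self (abs_nonneg _) hM).trans (le_trans ?_ h2)
  refine abs_integral_le_integral_abs.trans (le_of_eq ?_)
  simp [abs_mul]

/-- Quotient rule. This recursion expresses the cumulant derivatives as polynomials in the tilted
moments. -/
theorem hasDerivAt_tiltedMoment (hs : s ∈ interior (integrableExpSet X μ)) (k : ℕ) :
    HasDerivAt (tiltedMoment X μ k)
      (tiltedMoment X μ (k + 1) s - tiltedMoment X μ k s * tiltedMoment X μ 1 s) s := by
  have hM : 0 < mgf X μ s := mgf_pos (interior_subset (s := integrableExpSet X μ) hs)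
  have h1 := hasDerivAt_integral_pow_mul_exp_real hs k
  have h2 := hasDerivAt_mgf hs
  refine (h1.div h2 hM.ne').congr_deriv ?_
  unfold tiltedMoment
  simp only [pow_one]
  field_simp

omit [IsProbabilityMeasure μ] in
theorem deriv_cgf_eq_tiltedMoment (hs : s ∈ interior (integrableExpSet X μ)) :
    deriv (cgf X μ) s = tiltedMoment X μ 1 s := by
  simp [deriv_cgf hs, tiltedMoment]

omit [IsProbabilityMeasure μ] in
theorem iteratedDeriv_two_cgf_eq_tiltedMoment (hs : s ∈ interior (integrableExpSet X μ)) :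
    iteratedDeriv 2 (cgf X μ) s = tiltedMoment X μ 2 s - tiltedMoment X μ 1 s ^ 2 := by
  rw [iteratedDeriv_two_cgf hs, deriv_cgf_eq_tiltedMoment hs]; rfl

omit [IsProbabilityMeasure μ] in
theorem hasDerivAt_cgf (hs : s ∈ interior (integrableExpSet X μ)) :
    HasDerivAt (cgf X μ) (deriv (cgf X μ) s) s :=
  (analyticAt_cgf hs).differentiableAt.hasDerivAt

omit [IsProbabilityMeasure μ] in
theorem hasDerivAt_deriv_cgf (hs : s ∈ interior (integrableExpSet X μ)) :
    HasDerivAt (deriv (cgf X μ)) (iteratedDeriv 2 (cgf X μ) s) s := by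
  rw [iteratedDeriv_succ, iteratedDeriv_one]
  exact (analyticAt_cgf hs).deriv.differentiableAt.hasDerivAt

theorem SubExponential.abs_iteratedDeriv_two_cgf_le (h : SubExponential X μ θ β) (hθ : 0 < θ)
    (hβ : 0 < β) (hs : |s| ≤ β / 4) :
    |iteratedDeriv 2 (cgf X μ) s| ≤ 2 * momentBound θ β ^ 2 := by
  have hA := one_le_momentBound hθ hβ
  rw [iteratedDeriv_two_cgf_eq_tiltedMoment (h.mem_interior hθ (by linarith))]
  have h1 := h.abs_tiltedMoment_le hθ hβ hs (k := 1) (by norm_num)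
  have h2 := h.abs_tiltedMoment_le hθ hβ hs (k := 2) (by norm_num)
  refine (abs_sub _ _).trans ?_
  rw [abs_pow]
  have h3 : |tiltedMoment X μ 1 s| ^ 2 ≤ momentBound θ β ^ 2 := by gcongr
  nlinarith

/-- The third derivative of the cumulant generating function is bounded near zero. -/
theorem SubExponential.hasDerivAt_iteratedDeriv_two_cgf (h : SubExponential X μ θ β) (hθ : 0 < θ)
    (hβ : 0 < β) (hs : |s| ≤ β / 4) :
    ∃ y, HasDerivAt (iteratedDeriv 2 (cgf X μ)) y s ∧ |y| ≤ 6 * momentBound θ β ^ 3 := by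
  have hA := one_le_momentBound hθ hβ
  have hmem := h.mem_interior hθ (s := s) (by linarith)
  have hev : iteratedDeriv 2 (cgf X μ) =ᶠ[𝓝 s]
      fun t => tiltedMoment X μ 2 t - tiltedMoment X μ 1 t ^ 2 := by
    filter_upwards [isOpen_interior.eventually_mem hmem] with t ht using
      iteratedDeriv_two_cgf_eq_tiltedMoment ht
  refine ⟨_, ((hasDerivAt_tiltedMoment hmem 2).sub
    ((hasDerivAt_tiltedMoment hmem 1).pow 2)).congr_of_eventuallyEq hev, ?_⟩
  have h1 := h.abs_tiltedMoment_le hθ hβ hs (k := 1) (by norm_num)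
  have h2 := h.abs_tiltedMoment_le hθ hβ hs (k := 2) (by norm_num)
  have h3 := h.abs_tiltedMoment_le hθ hβ hs (k := 3) (by norm_num)
  set A := momentBound θ β
  set a := tiltedMoment X μ 1 s
  -- The third derivative is the third cumulant `c - 3 a b + 2 a³` of the tilted law, so six copies
  -- of `A³` bound it.
  set b := tiltedMoment X μ 2 s
  set c := tiltedMoment X μ 3 s
  have e : tiltedMoment X μ (2 + 1) s - b * a -
      (2 : ℕ) * a ^ (2 - 1) * (tiltedMoment X μ (1 + 1) s - a * a) =
      c - 3 * (a * b) + 2 * a ^ 3 := by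
    change c - b * a - (2 : ℕ) * a ^ (2 - 1) * (b - a * a) = _
    norm_num
    ring
  rw [e]
  have hab : |a * b| ≤ A ^ 2 := by
    rw [abs_mul, sq]; gcongr
  have ha3 : |a ^ 3| ≤ A ^ 3 := by rw [abs_pow]; gcongr
  have hA2 : A ≤ A ^ 3 := by nlinarith [sq_nonneg (A - 1), sq_nonneg A]
  have hA3 : A ^ 2 ≤ A ^ 3 := pow_le_pow_right₀ hA (by norm_num)
  rw [abs_le] at *
  constructor <;> linarith [hab.1, hab.2, ha3.1, ha3.2, h3.1, h3.2]

/-- Mean value inequality: the second derivative at zero is the second moment, the mean being zero,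
and the third derivative is bounded. -/
theorem SubExponential.abs_iteratedDeriv_two_cgf_sub_le (h : SubExponential X μ θ β) (hθ : 0 < θ)
    (hβ : 0 < β) (hs : |s| ≤ β / 4) :
    |iteratedDeriv 2 (cgf X μ) s - ∫ ω, X ω ^ 2 ∂μ| ≤ 6 * momentBound θ β ^ 3 * |s| := by
  have h0 : iteratedDeriv 2 (cgf X μ) 0 = ∫ ω, X ω ^ 2 ∂μ := by
    have hm : (0 : ℝ) ∈ interior (integrableExpSet X μ) := h.mem_interior hθ (by simpa using hβ)
    rw [iteratedDeriv_two_cgf_eq_tiltedMoment hm]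
    simp [tiltedMoment, h.mean]
  have hmem : ∀ t ∈ Set.Icc (-(β / 4)) (β / 4), |t| ≤ β / 4 := fun t ht => abs_le.2 ht
  choose y hy using fun t : Set.Icc (-(β / 4)) (β / 4) =>
    h.hasDerivAt_iteratedDeriv_two_cgf hθ hβ (hmem t t.2)
  have key := (convex_Icc (-(β / 4)) (β / 4)).norm_image_sub_le_of_norm_deriv_le
    (f := iteratedDeriv 2 (cgf X μ)) (C := 6 * momentBound θ β ^ 3)
    (fun t ht => (hy ⟨t, ht⟩).1.differentiableAt)
    (fun t ht => by rw [(hy ⟨t, ht⟩).1.deriv]; exact (hy ⟨t, ht⟩).2)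
    (Set.mem_Icc.2 ⟨by linarith, by linarith⟩) (Set.mem_Icc.2 (abs_le.1 hs)) (x := 0) (y := s)
  rw [h0] at key
  simpa using key

/-- Second order expansion of the Legendre transform of the cumulant generating function. -/
theorem SubExponential.abs_legendre_sub_le (h : SubExponential X μ θ β) (hθ : 0 < θ)
    (hβ : 0 < β) (hs : |s| ≤ β / 4) :
    |s * deriv (cgf X μ) s - cgf X μ s - s ^ 2 * iteratedDeriv 2 (cgf X μ) s / 2| ≤
      3 * momentBound θ β ^ 3 * |s| ^ 3 := by
  -- The derivative of `ψ` is `-t² K'''(t) / 2`, since all lower-order terms cancel, and `ψ 0 = 0`.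
  set ψ : ℝ → ℝ := fun t =>
    t * deriv (cgf X μ) t - cgf X μ t - t ^ 2 * iteratedDeriv 2 (cgf X μ) t / 2 with hψ
  have hder : ∀ t ∈ Set.uIcc 0 s, ∃ y, HasDerivWithinAt ψ y (Set.uIcc 0 s) t ∧
      ‖y‖ ≤ 3 * momentBound θ β ^ 3 * |s| ^ 2 := by
    intro t ht
    have hts : |t| ≤ |s| := by simpa using Set.abs_sub_left_of_mem_uIcc ht
    have htβ := hts.trans hs
    have hm := h.mem_interior hθ (s := t) (by linarith)
    obtain ⟨y, hy, hyb⟩ := h.hasDerivAt_iteratedDeriv_two_cgf hθ hβ htβ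
    refine ⟨-(t ^ 2 * y / 2), ?_, ?_⟩
    · have := ((((hasDerivAt_id t).mul (hasDerivAt_deriv_cgf hm)).sub (hasDerivAt_cgf hm)).sub
        (((hasDerivAt_pow 2 t).mul hy).div_const 2)).hasDerivWithinAt (s := Set.uIcc 0 s)
      refine (this.congr_deriv ?_).congr (fun _ _ => rfl) rfl
      simp
      ring
    · rw [norm_neg, Real.norm_eq_abs, abs_div, abs_mul, abs_pow, abs_two]
      have : |t| ^ 2 * |y| ≤ |s| ^ 2 * (6 * momentBound θ β ^ 3) := by gcongr
      linarith
  choose! y hy using hder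
  have key := (convex_uIcc 0 s).norm_image_sub_le_of_norm_hasDerivWithin_le
    (fun t ht => (hy t ht).1) (fun t ht => (hy t ht).2) Set.left_mem_uIcc Set.right_mem_uIcc
  have h0 : ψ 0 = 0 := by simp [hψ]
  rw [h0, sub_zero, sub_zero, Real.norm_eq_abs, Real.norm_eq_abs] at key
  refine key.trans (le_of_eq ?_)
  ring

end SubExponential

/-! ### Stability of the Lugannani–Rice expression when `r` is close to `λ` -/

/-- The Lugannani-Rice expression as a function of `r` and `λ`. -/
noncomputable def lrValue (r l : ℝ) : ℝ :=
  1 - cdf (gaussianReal 0 1) r + gaussianPDFReal 0 1 r * (1 / l - 1 / r)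

theorem lrValue_neg (r l : ℝ) : lrValue (-r) (-l) = 1 - lrValue r l := by
  unfold lrValue
  rw [cdf_gaussianReal_neg, gaussianPDFReal_neg, one_div_neg_eq_neg_one_div,
    one_div_neg_eq_neg_one_div]
  ring

/-- As `mills` decreases and `x * mills x` increases, the ratio of two values of `mills` lies
between one and the inverse ratio of the arguments. -/
theorem abs_mills_sub_le {r l k : ℝ} (hl : 0 < l) (hk : k ≤ 1 / 2) (h : |r - l| ≤ k * l) :
    |mills r - mills l| ≤ 2 * k * mills l := by
  have hm := mills_pos l
  have hmr := mills_pos r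
  obtain ⟨h1, h2⟩ := abs_le.1 h
  have hk0 : 0 ≤ k := nonneg_of_mul_nonneg_left ((abs_nonneg _).trans h) hl
  have hr : 0 < r := by nlinarith
  rcases le_total l r with hlr | hlr
  · have h3 := mills_le_mul_mills_mul (c := r / l) ((one_le_div hl).2 hlr) l
    rw [div_mul_cancel₀ _ hl.ne', div_mul_eq_mul_div, le_div_iff₀ hl] at h3
    have h4 := mills_antitone hlr
    rw [abs_of_nonpos (by linarith)]
    have h5 : l * (mills l - mills r) ≤ l * (k * mills l) := by nlinarith
    have h6 := le_of_mul_le_mul_left h5 hl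
    nlinarith
  · have h3 := mills_le_mul_mills_mul (c := l / r) ((one_le_div hr).2 hlr) r
    rw [div_mul_cancel₀ _ hr.ne', div_mul_eq_mul_div, le_div_iff₀ hr] at h3
    have h4 := mills_antitone hlr
    rw [abs_of_nonneg (by linarith)]
    have h5 : r * (mills r - mills l) ≤ r * (2 * k * mills l) := by
      have : l - r ≤ 2 * k * r := by nlinarith
      nlinarith
    exact le_of_mul_le_mul_left h5 hr

theorem abs_inv_sub_inv_le {r l k : ℝ} (hl : 0 < l) (hk : k ≤ 1 / 2) (h : |r - l| ≤ k * l) :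
    |1 / l - 1 / r| ≤ 2 * k / l := by
  obtain ⟨h1, h2⟩ := abs_le.1 h
  have hk0 : 0 ≤ k := nonneg_of_mul_nonneg_left ((abs_nonneg _).trans h) hl
  have hr : l / 2 ≤ r := by nlinarith
  have hr0 : 0 < r := by linarith
  have e : 1 / l - 1 / r = (r - l) / (l * r) := by field_simp
  rw [e, abs_div, abs_of_pos (mul_pos hl hr0), div_le_div_iff₀ (mul_pos hl hr0) hl]
  calc |r - l| * l ≤ k * l * l := by gcongr
    _ = 2 * k * (l * (l / 2)) := by ring
    _ ≤ 2 * k * (l * r) := by gcongr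

theorem gaussianPDFReal_pos' (x : ℝ) : 0 < gaussianPDFReal 0 1 x :=
  gaussianPDFReal_pos _ _ _ one_ne_zero

/-- The Lugannani-Rice expression with `r` close to `λ > 0`. -/
theorem abs_lrValue_sub_le {r l k : ℝ} (hl : 0 < l) (hk : k ≤ 1 / 2) (h : |r - l| ≤ k * l) :
    |lrValue r l - gaussianPDFReal 0 1 r * mills l| ≤
      (2 * k + 2 * (k + k / l) / mills 1) * (gaussianPDFReal 0 1 r * mills l) := by
  have hk0 : 0 ≤ k := nonneg_of_mul_nonneg_left ((abs_nonneg _).trans h) hl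
  have hφ := gaussianPDFReal_pos' r
  have e : lrValue r l - gaussianPDFReal 0 1 r * mills l =
      gaussianPDFReal 0 1 r * ((mills r - mills l) + (1 / l - 1 / r)) := by
    unfold lrValue
    rw [one_sub_cdf_gaussianReal]; ring
  -- The difference of reciprocals is made relative to `mills l` through its lower bound. In the
  -- application `k = O(s)` and `l = s √V`, so both `k` and `k / l` are small.
  have h1 : 2 * k / l ≤ 2 * (k + k / l) / mills 1 * mills l := by
    have h2 := mills_lower hl.le
    have h3 : 1 ≤ (1 + l) * mills l / mills 1 := (one_le_div (mills_pos 1)).2 h2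
    have h4 : 0 ≤ 2 * k / l := by positivity
    calc 2 * k / l ≤ 2 * k / l * ((1 + l) * mills l / mills 1) := le_mul_of_one_le_right h4 h3
      _ = _ := by field_simp; ring
  rw [e, abs_mul, abs_of_pos hφ]
  calc _ ≤ gaussianPDFReal 0 1 r * (2 * k * mills l + 2 * (k + k / l) / mills 1 * mills l) := by
        refine mul_le_mul_of_nonneg_left ((abs_add_le _ _).trans (add_le_add
          (abs_mills_sub_le hl hk h) ((abs_inv_sub_inv_le hl hk h).trans h1))) hφ.le
    _ = _ := by ring

theorem gaussianPDFReal_mul_mills_le {r l : ℝ} (hl : 0 ≤ l) :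
    gaussianPDFReal 0 1 r * mills l ≤ 1 / 2 := by
  rw [← mills_zero]
  have h1 : gaussianPDFReal 0 1 r ≤ gaussianPDFReal 0 1 0 := by
    rw [gaussianPDFReal_zero_one, gaussianPDFReal_zero_one]
    exact mul_le_mul_of_nonneg_left (Real.exp_le_exp.2 (by nlinarith [sq_nonneg r])) (by positivity)
  exact mul_le_mul h1 (mills_antitone hl) (mills_pos _).le (gaussianPDFReal_pos' _).le

/-! ### Error bounds for a single row -/

section Row

variable {Ω ι : Type*} [MeasurableSpace Ω] {μ : Measure Ω} [IsProbabilityMeasure μ] [Fintype ι]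
  {W : ι → Ω → ℝ} {θ β c s : ℝ}

theorem abs_sum_iteratedDeriv_two_sub_le (hW : ∀ i, SubExponential (W i) μ θ β) (hθ : 0 < θ)
    (hβ : 0 < β) (hs : |s| ≤ β / 4) :
    |∑ i, iteratedDeriv 2 (cgf (W i) μ) s - ∑ i, ∫ ω, W i ω ^ 2 ∂μ| ≤
      6 * momentBound θ β ^ 3 * |s| * Fintype.card ι := by
  rw [← Finset.sum_sub_distrib]
  refine (Finset.abs_sum_le_sum_abs _ _).trans ((Finset.sum_le_card_nsmul _ _ _ fun i _ =>
    (hW i).abs_iteratedDeriv_two_cgf_sub_le hθ hβ hs).trans (le_of_eq ?_))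
  rw [nsmul_eq_mul, Finset.card_univ]; ring

/-- The smallness condition on `s` limits the deviation from the untilted variance sum to a quarter
of `c n`. -/
theorem le_sum_iteratedDeriv_two (hW : ∀ i, SubExponential (W i) μ θ β) (hθ : 0 < θ)
    (hβ : 0 < β) (hs : |s| ≤ β / 4) (hsc : 24 * momentBound θ β ^ 3 * |s| ≤ c)
    (hc : c * Fintype.card ι ≤ ∑ i, ∫ ω, W i ω ^ 2 ∂μ) :
    c * Fintype.card ι / 2 ≤ ∑ i, iteratedDeriv 2 (cgf (W i) μ) s := by
  have h := (abs_le.1 (abs_sum_iteratedDeriv_two_sub_le hW hθ hβ hs)).1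
  have h1 : 24 * momentBound θ β ^ 3 * |s| * Fintype.card ι ≤ c * Fintype.card ι := by gcongr
  have h2 : 0 ≤ momentBound θ β ^ 3 * |s| * Fintype.card ι := by
    have := one_le_momentBound hθ hβ
    positivity
  linarith

theorem abs_sum_legendre_sub_le (hW : ∀ i, SubExponential (W i) μ θ β) (hθ : 0 < θ)
    (hβ : 0 < β) (hs : |s| ≤ β / 4) :
    |s * ∑ i, deriv (cgf (W i) μ) s - ∑ i, cgf (W i) μ s -
      s ^ 2 * (∑ i, iteratedDeriv 2 (cgf (W i) μ) s) / 2| ≤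
      3 * momentBound θ β ^ 3 * |s| ^ 3 * Fintype.card ι := by
  rw [Finset.mul_sum, Finset.mul_sum, Finset.sum_div, ← Finset.sum_sub_distrib,
    ← Finset.sum_sub_distrib]
  refine (Finset.abs_sum_le_sum_abs _ _).trans ((Finset.sum_le_card_nsmul _ _ _ fun i _ =>
    (hW i).abs_legendre_sub_le hθ hβ hs).trans (le_of_eq ?_))
  rw [nsmul_eq_mul, Finset.card_univ]; ring

/-- The constant in the error bound for the Lugannani-Rice approximation. -/
noncomputable def rowConst (A c : ℝ) : ℝ :=
  2176 * A / (c * gaussianPDFReal 0 1 0 * mills 1) + 24 * A ^ 3 / c * (1 + 1 / mills 1)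

theorem rowConst_pos {A c : ℝ} (hA : 0 < A) (hc : 0 < c) : 0 < rowConst A c := by
  have := mills_pos 1
  have := gaussianPDFReal_pos' 0
  unfold rowConst
  positivity

/-- `r` and `λ` differ by a factor close to one. -/
theorem abs_sqrt_legendre_sub_le (hW : ∀ i, SubExponential (W i) μ θ β) (hθ : 0 < θ)
    (hβ : 0 < β) (hs0 : 0 ≤ s) (hs : s ≤ β / 4) (hc0 : 0 < c)
    (hsc : 24 * momentBound θ β ^ 3 * s ≤ c)
    (hc : c * Fintype.card ι ≤ ∑ i, ∫ ω, W i ω ^ 2 ∂μ) :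
    0 ≤ s * ∑ i, deriv (cgf (W i) μ) s - ∑ i, cgf (W i) μ s ∧
    |√(2 * (s * ∑ i, deriv (cgf (W i) μ) s - ∑ i, cgf (W i) μ s)) -
        s * √(∑ i, iteratedDeriv 2 (cgf (W i) μ) s)| ≤
      12 * momentBound θ β ^ 3 * s / c * (s * √(∑ i, iteratedDeriv 2 (cgf (W i) μ) s)) := by
  have hsa : |s| = s := abs_of_nonneg hs0
  have hV := le_sum_iteratedDeriv_two hW hθ hβ (by rwa [hsa]) (by rwa [hsa]) hc
  have hL := abs_sum_legendre_sub_le hW hθ hβ (s := s) (by rwa [hsa])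
  rw [hsa] at hL
  have hA := one_le_momentBound hθ hβ
  set A := momentBound θ β
  set V := ∑ i, iteratedDeriv 2 (cgf (W i) μ) s
  set q := s * ∑ i, deriv (cgf (W i) μ) s - ∑ i, cgf (W i) μ s
  have hV0 : 0 ≤ V := le_trans (by positivity) hV
  set k := 12 * A ^ 3 * s / c with hk
  have hk0 : 0 ≤ k := by positivity
  have hk1 : k ≤ 1 / 2 := by rw [hk, div_le_iff₀ hc0]; linarith
  -- The lower bound `V ≥ c n / 2` turns the cubic Taylor error into a small multiple of `s² V =
  -- l²`.
  have h1 : 3 * A ^ 3 * s ^ 3 * Fintype.card ι ≤ k / 2 * (s ^ 2 * V) := by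
    have : k / 2 * (s ^ 2 * V) ≥ k / 2 * (s ^ 2 * (c * Fintype.card ι / 2)) := by gcongr
    refine le_trans (le_of_eq ?_) this
    rw [hk]; field_simp; ring
  obtain ⟨h2, h3⟩ := abs_le.1 (hL.trans h1)
  have h4 : 0 ≤ s ^ 2 * V := by positivity
  have hq : 0 ≤ q := by nlinarith
  refine ⟨hq, ?_⟩
  set l := s * √V
  have hl0 : 0 ≤ l := by positivity
  have hl2 : l ^ 2 = s ^ 2 * V := by rw [mul_pow, Real.sq_sqrt hV0]
  have hr2 : √(2 * q) ^ 2 = 2 * q := Real.sq_sqrt (by positivity)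
  have hr0 : 0 ≤ √(2 * q) := Real.sqrt_nonneg _
  set r := √(2 * q)
  rcases hl0.eq_or_lt with hl | hl
  · have : r ^ 2 = 0 := by
      rw [hr2]
      have : s ^ 2 * V = 0 := by rw [← hl2, ← hl]; norm_num
      rw [this] at h2 h3
      linarith
    rw [pow_eq_zero_iff two_ne_zero] at this
    rw [this, ← hl]; simp
  · have h5 : |r - l| * (r + l) ≤ k * l * l := by
      rw [← abs_of_nonneg (by positivity : 0 ≤ r + l), ← abs_mul]
      have : (r - l) * (r + l) = 2 * q - s ^ 2 * V := by rw [← hr2, ← hl2]; ring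
      rw [this, abs_le, mul_assoc, ← sq, hl2]
      constructor <;> linarith
    have h6 : |r - l| * l ≤ k * l * l :=
      le_trans (mul_le_mul_of_nonneg_left (by linarith) (abs_nonneg _)) h5
    exact le_of_mul_le_mul_right h6 hl

/-- Error bounds for both tails and the Lugannani-Rice expression at a nonnegative saddlepoint. -/
theorem row_estimate_nonneg (hW : ∀ i, SubExponential (W i) μ θ β) (hind : iIndepFun W μ)
    (hθ : 0 < θ) (hβ : 0 < β) (hs0 : 0 ≤ s) (hs : s ≤ β / 4) (hc0 : 0 < c)
    (hsc : 24 * momentBound θ β ^ 3 * s ≤ c) (hN : 8 * momentBound θ β ^ 2 ≤ c * Fintype.card ι)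
    (hc : c * Fintype.card ι ≤ ∑ i, ∫ ω, W i ω ^ 2 ∂μ) {x V r u : ℝ}
    (hx : x = ∑ i, deriv (cgf (W i) μ) s) (hV : V = ∑ i, iteratedDeriv 2 (cgf (W i) μ) s)
    (hr : r = √(2 * (s * x - ∑ i, cgf (W i) μ s)))
    (hu : u = rowConst (momentBound θ β) c * (s + 1 / √V)) :
    ∃ T, 0 < T ∧ T ≤ 1 / 2 ∧ |μ.real {ω | x ≤ ∑ i, W i ω} - T| ≤ u * T ∧
      |μ.real {ω | x < ∑ i, W i ω} - T| ≤ u * T ∧ |lrValue r (s * √V) - T| ≤ u * T := by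
  have hsa : |s| = s := abs_of_nonneg hs0
  have hVc := le_sum_iteratedDeriv_two hW hθ hβ (by rwa [hsa]) (by rwa [hsa]) hc
  obtain ⟨hq, hrl⟩ := abs_sqrt_legendre_sub_le hW hθ hβ hs0 hs hc0 hsc hc
  rw [← hx, ← hV, ← hr] at hrl
  rw [← hV] at hVc
  rw [← hx] at hq
  have hA := one_le_momentBound hθ hβ
  have hmem : ∀ i, s ∈ interior (integrableExpSet (W i) μ) := fun i =>
    (hW i).mem_interior hθ (by rw [hsa]; linarith)
  have hv : ∀ i, iteratedDeriv 2 (cgf (W i) μ) s ≤ 2 * momentBound θ β ^ 2 := fun i =>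
    (le_abs_self _).trans ((hW i).abs_iteratedDeriv_two_cgf_le hθ hβ (by rwa [hsa]))
  have h3 := fun i => (hW i).integral_tilted_abs_pow_three_le hθ hβ (s := s) (by rwa [hsa])
  set A := momentBound θ β
  have hA0 : 0 < A := by linarith
  have hA2 : 0 < A ^ 2 := by positivity
  have hV0 : 0 < V := by linarith
  have hσ : 0 < √V := Real.sqrt_pos.2 hV0
  -- No summand carries more than half the variance: each is at most `2 A²`, while `hN` and `V ≥ c n
  -- / 2` give `V ≥ 4 A²`.
  obtain ⟨ht1, ht2⟩ := tail_sum_estimate (fun i => (hW i).measurable) hind hs0 hmem hA0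
    h3 hV hV0 (fun i => (hv i).trans (by linarith)) hx
  set l := s * √V with hl
  have hl0 : 0 ≤ l := by positivity
  have hm1 := mills_pos 1
  have hml := mills_pos l
  have hφ0 := gaussianPDFReal_pos' 0
  set φ0 := gaussianPDFReal 0 1 0 with hφ0def
  -- Since `r² / 2` equals the Legendre exponent, undoing the tilt turns `φ(0)` into `φ(r)`.
  have hφr : gaussianPDFReal 0 1 r = φ0 * Real.exp (-(s * x - ∑ i, cgf (W i) μ s)) := by
    rw [hφ0def, gaussianPDFReal_zero_one, gaussianPDFReal_zero_one, hr]
    rw [neg_div, Real.sq_sqrt (by linarith)]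
    simp
  set q := s * x - ∑ i, cgf (W i) μ s
  have hs' : 0 ≤ s + 1 / √V := by positivity
  have hu1 : 2176 * A / (c * φ0 * mills 1) * (s + 1 / √V) ≤ u := by
    rw [hu, rowConst]
    gcongr
    have : 0 ≤ 24 * A ^ 3 / c * (1 + 1 / mills 1) := by positivity
    linarith
  have hu2 : 24 * A ^ 3 / c * (1 + 1 / mills 1) * (s + 1 / √V) ≤ u := by
    rw [hu, rowConst]
    gcongr
    have : 0 ≤ 2176 * A / (c * φ0 * mills 1) := by positivity
    linarith
  have htail : ∀ p : ℝ, |Real.exp q * p - φ0 * mills l| ≤ 1088 * A * Fintype.card ι / (V * √V) →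
      |p - gaussianPDFReal 0 1 r * mills l| ≤ u * (gaussianPDFReal 0 1 r * mills l) := by
    intro p hp
    have e : p - gaussianPDFReal 0 1 r * mills l =
        Real.exp (-q) * (Real.exp q * p - φ0 * mills l) := by
      rw [hφr, mul_sub, ← mul_assoc, ← Real.exp_add, neg_add_cancel, Real.exp_zero]
      ring
    have h5 : 1088 * A * Fintype.card ι / (V * √V) ≤ 2176 * A / (c * √V) := by
      rw [div_le_div_iff₀ (by positivity) (by positivity)]
      have : 1088 * A * √V * (c * Fintype.card ι) ≤ 1088 * A * √V * (2 * V) := by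
        exact mul_le_mul_of_nonneg_left (by linarith) (by positivity)
      linarith
    have h6 : 2176 * A / (c * √V) ≤ u * (φ0 * mills l) := by
      -- Makes the error relative: the extra factor `1 + l = 1 + s √V` turns `1/√V` into `s + 1/√V`.
      have h7 : 1 ≤ (1 + l) * mills l / mills 1 := (one_le_div hm1).2 (mills_lower hl0)
      calc 2176 * A / (c * √V) ≤ 2176 * A / (c * √V) * ((1 + l) * mills l / mills 1) :=
            le_mul_of_one_le_right (by positivity) h7
        _ = 2176 * A / (c * φ0 * mills 1) * (s + 1 / √V) * (φ0 * mills l) := by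
            rw [hl]; field_simp; ring
        _ ≤ u * (φ0 * mills l) := by gcongr
    rw [e, abs_mul, Real.abs_exp, hφr]
    calc _ ≤ Real.exp (-q) * (u * (φ0 * mills l)) := by
          gcongr; exact hp.trans (h5.trans h6)
      _ = _ := by ring
  refine ⟨gaussianPDFReal 0 1 r * mills l, mul_pos (gaussianPDFReal_pos' r) hml,
    gaussianPDFReal_mul_mills_le hl0, htail _ ht1, htail _ ht2, ?_⟩
  rcases hl0.eq_or_lt with hl' | hl'
  -- At a zero saddlepoint both reciprocals are `1/0 = 0`, and the formula equals the main term
  -- exactly.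
  · have hr0 : r = 0 := by
      rw [← hl'] at hrl
      simpa using hrl
    have hT : 0 ≤ gaussianPDFReal 0 1 0 * mills 0 := by rw [mills_zero]; norm_num
    rw [← hl', hr0]
    have : lrValue 0 0 - gaussianPDFReal 0 1 0 * mills 0 = 0 := by
      unfold lrValue
      rw [one_sub_cdf_gaussianReal]; simp
    rw [this, abs_zero]
    exact mul_nonneg (le_trans (by positivity) hu1) hT
  · have hk1 : 12 * A ^ 3 * s / c ≤ 1 / 2 := by rw [div_le_iff₀ hc0]; linarith
    have hs1 : 0 < s := by
      rcases hs0.eq_or_lt with h | h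
      · rw [hl, ← h, zero_mul] at hl'; exact absurd hl' (lt_irrefl _)
      · exact h
    refine (abs_lrValue_sub_le hl' hk1 hrl).trans ?_
    refine mul_le_mul_of_nonneg_right (le_trans ?_ hu2)
      (mul_pos (gaussianPDFReal_pos' r) hml).le
    have e : 12 * A ^ 3 * s / c / l = 12 * A ^ 3 / c * (1 / √V) := by
      rw [hl]; field_simp
    rw [e]
    have h8 : 0 ≤ 24 * A ^ 3 / c * (1 / √V) := by positivity
    have e2 : 24 * A ^ 3 / c * (1 + 1 / mills 1) * (s + 1 / √V) =
      2 * (12 * A ^ 3 * s / c) + 2 * (12 * A ^ 3 * s / c + 12 * A ^ 3 / c * (1 / √V)) / mills 1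
        + 24 * A ^ 3 / c * (1 / √V) := by
      field_simp; ring
    linarith

omit [IsProbabilityMeasure μ] in
theorem cgf_neg_fun (X : Ω → ℝ) : cgf (-X) μ = fun t => cgf X μ (-t) := by
  ext t; exact cgf_neg

omit [IsProbabilityMeasure μ] in
theorem deriv_cgf_neg (X : Ω → ℝ) (t : ℝ) : deriv (cgf (-X) μ) (-t) = -deriv (cgf X μ) t := by
  rw [cgf_neg_fun, deriv_comp_neg, neg_neg]

omit [IsProbabilityMeasure μ] in
theorem iteratedDeriv_two_cgf_neg (X : Ω → ℝ) (t : ℝ) :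
    iteratedDeriv 2 (cgf (-X) μ) (-t) = iteratedDeriv 2 (cgf X μ) t := by
  rw [cgf_neg_fun, iteratedDeriv_comp_neg]; simp

/-- Relative error bound for the Lugannani-Rice approximation of a single tail probability. -/
theorem row_estimate (hW : ∀ i, SubExponential (W i) μ θ β) (hind : iIndepFun W μ)
    (hθ : 0 < θ) (hβ : 0 < β) (hs : |s| ≤ β / 4) (hc0 : 0 < c)
    (hsc : 24 * momentBound θ β ^ 3 * |s| ≤ c) (hN : 8 * momentBound θ β ^ 2 ≤ c * Fintype.card ι)
    (hc : c * Fintype.card ι ≤ ∑ i, ∫ ω, W i ω ^ 2 ∂μ) {x V r u : ℝ}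
    (hx : x = ∑ i, deriv (cgf (W i) μ) s) (hV : V = ∑ i, iteratedDeriv 2 (cgf (W i) μ) s)
    (hr : r = Real.sign s * √(2 * (s * x - ∑ i, cgf (W i) μ s)))
    (hu : u = rowConst (momentBound θ β) c * (|s| + 1 / √V)) (hu4 : u ≤ 1 / 4) :
    0 ≤ s * x - ∑ i, cgf (W i) μ s ∧ 0 < lrValue r (s * √V) ∧
    |μ.real {ω | x ≤ ∑ i, W i ω} - lrValue r (s * √V)| ≤ 4 * u * lrValue r (s * √V) := by
  have hrc := rowConst_pos (A := momentBound θ β) (by linarith [one_le_momentBound hθ hβ]) hc0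
  have hu0 : 0 ≤ u := by rw [hu]; positivity
  rcases le_or_gt 0 s with hs0 | hs0
  · rw [abs_of_nonneg hs0] at hs hsc hu
    have hq := (abs_sqrt_legendre_sub_le hW hθ hβ hs0 hs hc0 hsc hc).1
    rw [← hx] at hq
    have hr' : r = √(2 * (s * x - ∑ i, cgf (W i) μ s)) := by
      rcases hs0.eq_or_lt with h | h
      · rw [hr, ← h]; simp
      · rw [hr, Real.sign_of_pos h, one_mul]
    obtain ⟨T, hT0, hT1, h1, -, h3⟩ := row_estimate_nonneg hW hind hθ hβ hs0 hs hc0 hsc hN hc hx hV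
      hr' hu
    set R := lrValue r (s * √V)
    have huT : u * T ≤ T / 4 := by nlinarith
    obtain ⟨h4, h5⟩ := abs_le.1 h3
    obtain ⟨h6, h7⟩ := abs_le.1 h1
    have hR : T * (3 / 4) ≤ R := by linarith
    refine ⟨hq, by linarith, ?_⟩
    have huR : u * (T * (3 / 4)) ≤ u * R := by gcongr
    have huT0 : 0 ≤ u * T := by positivity
    rw [abs_le]
    constructor <;> linarith
  -- Reflect the variables: the saddlepoint becomes positive, and the event becomes the complement
  -- of a strict upper tail.
  · rw [abs_of_neg hs0] at hs hsc hu
    have hW' : ∀ i, SubExponential (-W i) μ θ β := fun i => (hW i).neg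
    have hind' : iIndepFun (fun i => -W i) μ := hind.comp (fun _ x => -x) fun _ => measurable_neg
    have hc' : c * Fintype.card ι ≤ ∑ i, ∫ ω, (-W i) ω ^ 2 ∂μ := by simpa using hc
    have hx' : -x = ∑ i, deriv (cgf (-W i) μ) (-s) := by
      simp only [deriv_cgf_neg, Finset.sum_neg_distrib]; rw [hx]
    have hV' : V = ∑ i, iteratedDeriv 2 (cgf (-W i) μ) (-s) := by
      simp only [iteratedDeriv_two_cgf_neg]; rw [hV]
    have hcgf : -s * -x - ∑ i, cgf (-W i) μ (-s) = s * x - ∑ i, cgf (W i) μ s := by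
      simp only [cgf_neg, neg_neg]; ring
    have hq := (abs_sqrt_legendre_sub_le hW' hθ hβ (by linarith) hs hc0 hsc hc').1
    rw [← hx', hcgf] at hq
    have hr' : -r = √(2 * (-s * -x - ∑ i, cgf (-W i) μ (-s))) := by
      rw [hcgf, hr, Real.sign_of_neg hs0]; ring
    obtain ⟨T, hT0, hT1, -, h2, h3⟩ := row_estimate_nonneg hW' hind' hθ hβ (by linarith) hs hc0
      hsc hN hc' hx' hV' hr' hu
    have hP : μ.real {ω | x ≤ ∑ i, W i ω} = 1 - μ.real {ω | -x < ∑ i, (-W i) ω} := by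
      rw [← probReal_compl_eq_one_sub]
      · congr 1
        ext ω
        simp
      · exact measurableSet_lt measurable_const 
          (Finset.measurable_fun_sum _ fun i _ => (hW' i).measurable)
    have hR : lrValue r (s * √V) = 1 - lrValue (-r) (-s * √V) := by
      rw [neg_mul, lrValue_neg]; ring
    rw [hP, hR]
    set R := lrValue (-r) (-s * √V)
    have huT : u * T ≤ T / 4 := by nlinarith
    have huT' : u * T ≤ u / 2 := by nlinarith
    obtain ⟨h4, h5⟩ := abs_le.1 h3
    obtain ⟨h6, h7⟩ := abs_le.1 h2
    -- Because `T ≤ 1/2`, the complement stays away from zero, so an absolute error is also a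
    -- relative one.
    have hR1 : 3 / 8 ≤ 1 - R := by linarith
    refine ⟨hq, by linarith, ?_⟩
    have huR : u * (3 / 8) ≤ u * (1 - R) := by gcongr
    rw [abs_le]
    constructor <;> linarith

end Row

/-! ### Solving the saddlepoint equation -/

section Saddle

variable {Ω ι : Type*} [MeasurableSpace Ω] {μ : Measure Ω} [IsProbabilityMeasure μ] [Fintype ι]
  {W : ι → Ω → ℝ} {θ β c ε η x : ℝ}

/-- Existence, localisation and uniqueness of the solution of the saddlepoint equation. -/
theorem exists_saddle_row (hW : ∀ i, SubExponential (W i) μ θ β) (hθ : 0 < θ) (hβ : 0 < β)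
    (hε : ∀ i, ∀ s ∈ Set.Ioo (-ε) ε, s ∈ interior (integrableExpSet (W i) μ)) (hη0 : 0 < η)
    (hηε : η ≤ ε / 2) (hηβ : η ≤ β / 4) (hηc : 24 * momentBound θ β ^ 3 * η ≤ c)
    (hc : c * Fintype.card ι ≤ ∑ i, ∫ ω, W i ω ^ 2 ∂μ)
    (hx : |x| < c * Fintype.card ι / 2 * η) :
    ∃ s₀, |s₀| ≤ η ∧ ∑ i, deriv (cgf (W i) μ) s₀ = x ∧
      ∀ s ∈ Set.Icc (-(ε / 2)) (ε / 2), ∑ i, deriv (cgf (W i) μ) s = x → s = s₀ := by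
  set f : ℝ → ℝ := fun s => ∑ i, deriv (cgf (W i) μ) s with hf
  have hder : ∀ s ∈ Set.Icc (-(ε / 2)) (ε / 2),
      HasDerivAt f (∑ i, iteratedDeriv 2 (cgf (W i) μ) s) s := fun s hs =>
    HasDerivAt.fun_sum fun i _ => hasDerivAt_deriv_cgf
      (hε i s ⟨by linarith [hs.1], by linarith [hs.2]⟩)
  have hsub : Set.Icc (-η) η ⊆ Set.Icc (-(ε / 2)) (ε / 2) :=
    Set.Icc_subset_Icc (by linarith) hηε
  have hcont : ContinuousOn f (Set.Icc (-(ε / 2)) (ε / 2)) := fun s hs =>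
    (hder s hs).continuousAt.continuousWithinAt
  -- Second cumulant derivatives are tilted variances, so monotonicity holds on the whole interval,
  -- even where `ε` exceeds the range of the quantitative bounds.
  have hmono : MonotoneOn f (Set.Icc (-(ε / 2)) (ε / 2)) := by
    refine monotoneOn_of_deriv_nonneg (convex_Icc _ _) hcont (fun s hs =>
      (hder s (interior_subset hs)).differentiableAt.differentiableWithinAt) fun s hs => ?_
    have hs' := interior_subset hs
    rw [(hder s hs').deriv]
    refine Finset.sum_nonneg fun i _ => ?_
    rw [← variance_tilted_mul (hε i s ⟨by linarith [hs'.1], by linarith [hs'.2]⟩)]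
    exact variance_nonneg _ _
  have hgrow : ∀ a ∈ Set.Icc (-η) η, ∀ b ∈ Set.Icc (-η) η, a ≤ b →
      c * Fintype.card ι / 2 * (b - a) ≤ f b - f a := by
    refine (convex_Icc (-η) η).mul_sub_le_image_sub_of_le_deriv (hcont.mono hsub)
      (fun s hs => (hder s (hsub (interior_subset hs))).differentiableAt.differentiableWithinAt)
      fun s hs => ?_
    have hs' : |s| ≤ η := abs_le.2 (interior_subset (s := Set.Icc (-η) η) hs)
    rw [(hder s (hsub (interior_subset hs))).deriv]
    refine le_sum_iteratedDeriv_two hW hθ hβ (hs'.trans hηβ) (le_trans ?_ hηc) hc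
    have := one_le_momentBound hθ hβ
    gcongr
  have hcard : 0 < c * Fintype.card ι / 2 := by
    by_contra hcon
    have : c * Fintype.card ι / 2 * η ≤ 0 := mul_nonpos_of_nonpos_of_nonneg (not_lt.1 hcon) hη0.le
    linarith [abs_nonneg x]
  have hm0 : (0 : ℝ) ∈ Set.Icc (-η) η := ⟨by linarith, hη0.le⟩
  have hml : -η ∈ Set.Icc (-η) η := ⟨le_rfl, by linarith⟩
  have hmr : η ∈ Set.Icc (-η) η := ⟨by linarith, le_rfl⟩
  have hf0 : f 0 = 0 := by
    simp only [hf]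
    refine Finset.sum_eq_zero fun i _ => ?_
    rw [deriv_cgf_zero ((hW i).mem_interior hθ (by simpa using hβ)), (hW i).mean, zero_div]
  obtain ⟨hx1, hx2⟩ := abs_lt.1 hx
  have hr : x < f η := by
    have := hgrow 0 hm0 η hmr hη0.le
    rw [hf0] at this
    linarith
  have hl : f (-η) < x := by
    have := hgrow (-η) hml 0 hm0 (by linarith)
    rw [hf0] at this
    linarith
  obtain ⟨s₀, hs₀, hs₀x⟩ := intermediate_value_Icc (by linarith : -η ≤ η) (hcont.mono hsub)
    ⟨hl.le, hr.le⟩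
  refine ⟨s₀, abs_le.2 hs₀, hs₀x, fun s hs hsx => ?_⟩
  change f s = x at hsx
  rcases lt_trichotomy s s₀ with h | h | h
  -- A second root below `s₀` would make `f` constant between `max s (-η)` and `s₀`, inside the
  -- region of strict growth. The bound `f (-η) < x` keeps `s₀` off the endpoint, so this segment is
  -- nondegenerate; the case above `s₀` is symmetric.
  · exfalso
    have ht : max s (-η) < s₀ := max_lt h (lt_of_le_of_ne hs₀.1 fun e => by
      rw [← e] at hs₀x; linarith)
    have htm : max s (-η) ∈ Set.Icc (-η) η := ⟨le_max_right _ _, ht.le.trans hs₀.2⟩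
    have h1 := hgrow _ htm _ hs₀ ht.le
    have h2 := hmono hs (hsub htm) (le_max_left _ _)
    have h3 := mul_pos hcard (sub_pos.2 ht)
    linarith
  · exact h
  · exfalso
    have ht : s₀ < min s η := lt_min h (lt_of_le_of_ne hs₀.2 fun e => by
      rw [e] at hs₀x; linarith)
    have htm : min s η ∈ Set.Icc (-η) η := ⟨hs₀.1.trans ht.le, min_le_right _ _⟩
    have h1 := hgrow _ hs₀ _ htm ht.le
    have h2 := hmono (hsub htm) hs (min_le_left _ _)
    have h3 := mul_pos hcard (sub_pos.2 ht)
    linarith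

end Saddle

/-! ### From rows to the triangular array -/

section Array

variable {Ω : Type*} [MeasurableSpace Ω] {μ : Measure Ω} {W : (n : ℕ) → Fin n → Ω → ℝ} {ε : ℝ}

theorem FiniteCGF.mem_interior (h : FiniteCGF W μ ε) {n : ℕ} (i : Fin n) {s : ℝ}
    (hs : s ∈ Set.Ioo (-ε) ε) : s ∈ interior (integrableExpSet (W n i) μ) :=
  _root_.mem_interior.2 ⟨Set.Ioo (-ε) ε, fun t ht => h n i t ht, isOpen_Ioo, hs⟩

theorem FiniteCGF.hasDerivAt_avgCGF (h : FiniteCGF W μ ε) (n : ℕ) {s : ℝ}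
    (hs : s ∈ Set.Ioo (-ε) ε) :
    HasDerivAt (avgCGF W μ n) (1 / (n : ℝ) * ∑ i, deriv (cgf (W n i) μ) s) s :=
  (HasDerivAt.fun_sum fun i _ => hasDerivAt_cgf (h.mem_interior i hs)).const_mul _

theorem FiniteCGF.iteratedDeriv_two_avgCGF (h : FiniteCGF W μ ε) (n : ℕ) {s : ℝ}
    (hs : s ∈ Set.Ioo (-ε) ε) :
    iteratedDeriv 2 (avgCGF W μ n) s =
      1 / (n : ℝ) * ∑ i, iteratedDeriv 2 (cgf (W n i) μ) s := by
  rw [iteratedDeriv_succ, iteratedDeriv_one]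
  have hev : deriv (avgCGF W μ n) =ᶠ[𝓝 s]
      fun t => 1 / (n : ℝ) * ∑ i, deriv (cgf (W n i) μ) t := by
    filter_upwards [isOpen_Ioo.eventually_mem hs] with t ht using (h.hasDerivAt_avgCGF n ht).deriv
  rw [hev.deriv_eq]
  exact ((HasDerivAt.fun_sum fun i _ =>
    hasDerivAt_deriv_cgf (h.mem_interior i hs)).const_mul _).deriv

theorem FiniteCGF.mem_solutionSet_iff (h : FiniteCGF W μ ε) (hε : 0 < ε) {n : ℕ} (hn : 0 < n)
    {w s : ℝ} : s ∈ solutionSet W μ ε n w ↔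
      s ∈ Set.Icc (-(ε / 2)) (ε / 2) ∧ ∑ i, deriv (cgf (W n i) μ) s = n * w := by
  have hn' : (0 : ℝ) < n := by exact_mod_cast hn
  refine and_congr_right fun hs => ?_
  have hd := h.hasDerivAt_avgCGF n (s := s) ⟨by linarith [hs.1], by linarith [hs.2]⟩
  constructor
  · intro h'
    rw [h'.unique hd]
    field_simp
  · intro h'
    rw [h'] at hd
    convert hd using 1
    field_simp

variable [IsProbabilityMeasure μ] {w : ℕ → ℝ} {θ β c : ℝ}

/-- Since `η` is arbitrary, this gives both eventual uniqueness in the fixed interval and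
convergence of the saddlepoint to zero. -/
theorem eventually_saddlepoint (hW : ∀ n i, SubExponential (W n i) μ θ β) (hθ : 0 < θ)
    (hβ : 0 < β) (hc0 : 0 < c)
    (hc : ∀ᶠ n : ℕ in atTop, c * n ≤ ∑ i : Fin n, ∫ ω, W n i ω ^ 2 ∂μ)
    (hw : Tendsto w atTop (𝓝 0)) (hε : 0 < ε) (h : FiniteCGF W μ ε) {η : ℝ} (hη : 0 < η) :
    ∀ᶠ n : ℕ in atTop, (∃! s, s ∈ solutionSet W μ ε n (w n)) ∧
      |saddlepoint W μ ε n (w n)| ≤ η ∧ |saddlepoint W μ ε n (w n)| ≤ ε / 2 ∧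
      ∑ i, deriv (cgf (W n i) μ) (saddlepoint W μ ε n (w n)) = n * w n := by
  have hA := one_le_momentBound hθ hβ
  -- The radius meets every constraint of the row lemma at once; `w n → 0` eventually beats the
  -- growth `c ζ / 2`.
  set ζ := min (min η (ε / 2)) (min (β / 4) (c / (24 * momentBound θ β ^ 3))) with hζ
  have hζ0 : 0 < ζ := by
    have : 0 < c / (24 * momentBound θ β ^ 3) := by positivity
    rw [hζ]
    exact lt_min (lt_min hη (by linarith)) (lt_min (by linarith) this)
  have hζη : ζ ≤ η := (min_le_left _ _).trans (min_le_left _ _)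
  have hζε : ζ ≤ ε / 2 := (min_le_left _ _).trans (min_le_right _ _)
  have hζβ : ζ ≤ β / 4 := (min_le_right _ _).trans (min_le_left _ _)
  have hζc : 24 * momentBound θ β ^ 3 * ζ ≤ c := by
    have h1 : ζ ≤ c / (24 * momentBound θ β ^ 3) := (min_le_right _ _).trans (min_le_right _ _)
    rw [le_div_iff₀ (by positivity)] at h1
    linarith
  have hsmall : ∀ᶠ n in atTop, |w n| < c / 2 * ζ := by
    have h1 := hw.abs
    rw [abs_zero] at h1
    exact h1.eventually (gt_mem_nhds (by positivity))
  filter_upwards [hc, hsmall, eventually_gt_atTop 0] with n hcn hwn hn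
  have hn' : (0 : ℝ) < n := by exact_mod_cast hn
  obtain ⟨s₀, hs₀, hs₀x, huniq⟩ := exists_saddle_row (x := n * w n) (hW n) hθ hβ
    (fun i s hs => h.mem_interior i hs) hζ0 hζε hζβ hζc (by simpa using hcn) (by
      rw [abs_mul, abs_of_pos hn', Fintype.card_fin]
      calc (n : ℝ) * |w n| < n * (c / 2 * ζ) := by gcongr
        _ = _ := by ring)
  have hex : ∃! s, s ∈ solutionSet W μ ε n (w n) := by
    refine ⟨s₀, (h.mem_solutionSet_iff hε hn).2 ⟨abs_le.1 (hs₀.trans hζε), hs₀x⟩, fun s hs => ?_⟩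
    obtain ⟨h1, h2⟩ := (h.mem_solutionSet_iff hε hn).1 hs
    exact huniq s h1 h2
  have hsad : saddlepoint W μ ε n (w n) = s₀ := by
    rw [saddlepoint, dif_pos hex]
    obtain ⟨h1, h2⟩ := (h.mem_solutionSet_iff hε hn).1 hex.choose_spec.1
    exact huniq _ h1 h2
  rw [hsad]
  exact ⟨hex, hs₀.trans hζη, hs₀.trans hζε, hs₀x⟩

end Array

end Saddlepoint

/-! ### Passage to the limit -/

theorem mainTheorem5 {Ω : Type*} [MeasurableSpace Ω] (μ : Measure Ω) [IsProbabilityMeasure μ]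
    (W : (n : ℕ) → Fin n → Ω → ℝ) (w : ℕ → ℝ) (θ β : ℝ)
    (hθ : 0 < θ) (hβ : 0 < β)
    (hmeas : ∀ (n : ℕ) (i : Fin n), Measurable (W n i))
    (hindep : ∀ n : ℕ, iIndepFun (W n) μ)
    (hmean : ∀ (n : ℕ) (i : Fin n), ∫ ω, W n i ω ∂μ = 0)
    (hsubexp : ∀ (n : ℕ) (i : Fin n) (t : ℝ), 0 < t →
      μ.real {ω | t ≤ |W n i ω|} ≤ θ * Real.exp (-β * t))
    (hvar : 0 < liminf (fun n : ℕ => (1 / (n : ℝ)) * ∑ i : Fin n, ∫ ω, (W n i ω) ^ 2 ∂μ) atTop)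
    (hw : Tendsto w atTop (𝓝 0)) :
    (∀ ε : ℝ, 0 < ε → ε ≤ β → Saddlepoint.FiniteCGF W μ ε) ∧
    ∀ ε : ℝ, 0 < ε → Saddlepoint.FiniteCGF W μ ε →
      (∀ᶠ n : ℕ in atTop, ∃! s : ℝ, s ∈ Saddlepoint.solutionSet W μ ε n (w n)) ∧
      ∃ e : ℕ → ℝ, Tendsto e atTop (𝓝 0) ∧ ∀ᶠ n : ℕ in atTop,
        μ.real {ω | w n ≤ Saddlepoint.rowAverage W n ω} =
          Saddlepoint.lugannaniRice W μ ε n (w n) * (1 + e n) := by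
  have hW : ∀ n i, Saddlepoint.SubExponential (W n i) μ θ β := fun n i =>
    ⟨hmeas n i, hmean n i, hsubexp n i⟩
  refine ⟨fun ε _ hεβ n i s hs => (hW n i).integrable_exp hθ ((abs_lt.2 hs).trans_le hεβ),
    fun ε hε h => ?_⟩
  obtain ⟨c, hc0, hcl⟩ := exists_between hvar
  have hc : ∀ᶠ n : ℕ in atTop, c * n ≤ ∑ i : Fin n, ∫ ω, W n i ω ^ 2 ∂μ := by
    -- The real-valued `liminf` requires boundedness below, provided here by nonnegativity of the
    -- second moments.
    have hev := eventually_lt_of_lt_liminf hcl ⟨0, by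
      simp only [eventually_map]
      exact Eventually.of_forall fun n => mul_nonneg (by positivity)
        (Finset.sum_nonneg fun i _ => integral_nonneg fun _ => sq_nonneg _)⟩
    filter_upwards [hev, eventually_gt_atTop 0] with n hn hn0
    have hn' : (0 : ℝ) < n := by exact_mod_cast hn0
    rw [one_div, inv_mul_eq_div, lt_div_iff₀ hn'] at hn
    exact hn.le
  have hsad : ∀ η : ℝ, 0 < η → _ := fun η hη =>
    Saddlepoint.eventually_saddlepoint hW hθ hβ hc0 hc hw hε h hη
  refine ⟨(hsad 1 one_pos).mono fun n hn => hn.1, ?_⟩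
  set A := Saddlepoint.momentBound θ β with hA
  have hA1 : 1 ≤ A := Saddlepoint.one_le_momentBound hθ hβ
  set s : ℕ → ℝ := fun n => Saddlepoint.saddlepoint W μ ε n (w n) with hs
  set V : ℕ → ℝ := fun n => ∑ i, iteratedDeriv 2 (cgf (W n i) μ) (s n) with hV
  set R : ℕ → ℝ := fun n => Saddlepoint.lugannaniRice W μ ε n (w n) with hR
  set P : ℕ → ℝ := fun n => μ.real {ω | w n ≤ Saddlepoint.rowAverage W n ω} with hP
  have hs0 : Tendsto s atTop (𝓝 0) := by
    rw [Metric.tendsto_atTop']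
    intro η hη
    obtain ⟨N, hN⟩ := eventually_atTop.1 (hsad (η / 2) (by linarith))
    refine ⟨N, fun n hn => ?_⟩
    rw [Real.dist_eq, sub_zero]
    linarith [(hN n hn.le).2.1]
  have hloc : ∀ᶠ n in atTop, |s n| ≤ β / 4 ∧ 24 * A ^ 3 * |s n| ≤ c := by
    filter_upwards [hsad (β / 4) (by linarith), hsad (c / (24 * A ^ 3)) (by positivity)]
      with n h1 h2
    refine ⟨h1.2.1, ?_⟩
    have := h2.2.1
    rw [le_div_iff₀ (by positivity)] at this
    linarith
  have hV0 : Tendsto (fun n => 1 / √(V n)) atTop (𝓝 0) := by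
    -- The variance grows at least like `c n / 2`, once the saddlepoint has entered the region where
    -- the lower bound applies.
    have hVtop : Tendsto V atTop atTop := by
      refine tendsto_atTop_mono' atTop (f₁ := fun n : ℕ => c * n / 2) ?_ ?_
      · filter_upwards [hloc, hc] with n hn hcn
        have := Saddlepoint.le_sum_iteratedDeriv_two (hW n) hθ hβ hn.1 hn.2 (by simpa using hcn)
        simpa using this
      · exact (tendsto_natCast_atTop_atTop.const_mul_atTop hc0).atTop_div_const two_pos
    simp_rw [one_div]
    exact (Real.tendsto_sqrt_atTop.comp hVtop).inv_tendsto_atTop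
  set u : ℕ → ℝ := fun n => Saddlepoint.rowConst A c * (|s n| + 1 / √(V n)) with hu
  have hu0 : Tendsto u atTop (𝓝 0) := by
    have := (hs0.abs.add hV0).const_mul (Saddlepoint.rowConst A c)
    simpa [hu] using this
  have key : ∀ᶠ n in atTop, 0 < R n ∧ |P n - R n| ≤ 4 * u n * R n := by
    have hlarge : ∀ᶠ n : ℕ in atTop, 8 * A ^ 2 ≤ c * n :=
      (tendsto_natCast_atTop_atTop.const_mul_atTop hc0).eventually_ge_atTop _
    filter_upwards [hsad 1 one_pos, hloc, hc, hlarge, eventually_gt_atTop 0,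
      hu0.eventually (ge_mem_nhds (by norm_num : (0 : ℝ) < 1 / 4))] with n h1 h2 h3 h4 hn h5
    have hn' : (0 : ℝ) < n := by exact_mod_cast hn
    obtain ⟨-, -, hsε, hsx⟩ := h1
    have hsm : s n ∈ Set.Ioo (-ε) ε := by
      rw [Set.mem_Ioo, ← abs_lt]; exact lt_of_le_of_lt hsε (by linarith)
    obtain ⟨e1, e2, e3⟩ := Saddlepoint.row_estimate (hW n) (hindep n) hθ hβ h2.1 hc0 h2.2
      (by simpa using h4) (by simpa using h3) hsx.symm (V := V n) rfl rfl (u := u n) rfl h5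
    have hq : (n : ℝ) * (s n * w n - Saddlepoint.avgCGF W μ n (s n)) =
        s n * (n * w n) - ∑ i, cgf (W n i) μ (s n) := by
      unfold Saddlepoint.avgCGF
      field_simp
    have hlam : Saddlepoint.lam W μ ε n (w n) = s n * √(V n) := by
      unfold Saddlepoint.lam
      rw [h.iteratedDeriv_two_avgCGF n hsm, ← mul_assoc, mul_one_div_cancel hn'.ne', one_mul]
    have hrr : Saddlepoint.rr W μ ε n (w n) = Real.sign (s n) *
        √(2 * (s n * (n * w n) - ∑ i, cgf (W n i) μ (s n))) := by
      unfold Saddlepoint.rr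
      rw [if_pos, mul_assoc 2 (n : ℝ), hq]
      rw [← hq] at e1
      exact nonneg_of_mul_nonneg_right e1 hn'
    have hRn : R n = Saddlepoint.lrValue (Real.sign (s n) *
        √(2 * (s n * (n * w n) - ∑ i, cgf (W n i) μ (s n)))) (s n * √(V n)) := by
      rw [hR, ← hlam, ← hrr]; rfl
    have hPn : P n = μ.real {ω | n * w n ≤ ∑ i, W n i ω} := by
      have hset : {ω | w n ≤ Saddlepoint.rowAverage W n ω} = {ω | n * w n ≤ ∑ i, W n i ω} := by
        ext ω
        simp only [Set.mem_ofPred_eq, Saddlepoint.rowAverage]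
        rw [one_div, inv_mul_eq_div, le_div_iff₀ hn', mul_comm]
      rw [hP, ← hset]
    rw [hRn, hPn]
    exact ⟨e2, e3⟩
  -- The exact relative error, meaningful because `R n` is eventually positive and bounded
  -- eventually by `4 u n`.
  refine ⟨fun n => P n / R n - 1, ?_, ?_⟩
  · refine squeeze_zero_norm' (a := fun n => 4 * u n) ?_ (by simpa using hu0.const_mul 4)
    filter_upwards [key] with n hn
    rw [Real.norm_eq_abs, div_sub_one hn.1.ne', abs_div, abs_of_pos hn.1, div_le_iff₀ hn.1]
    exact hn.2
  · filter_upwards [key] with n hn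
    change P n = R n * (1 + (P n / R n - 1))
    rw [add_sub_cancel, mul_div_cancel₀ _ hn.1.ne']
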